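/- Let $\pi$ be a (discrete) group and $G=\pi\times\pi$. Let $\mathcal D$ be the smallest family of subgroups of $G$ which contains the diagonal and the trivial subgroup and is closed under conjugation and finite intersections. Let $\mathcal{O_D}$ be the orbit category: its objects are the orbits $G/H$, $H\in\mathcal D$, and its morphisms are the $G$-maps. An $\mathcal{O_D}$-module is a contravariant functor $\underline M$ from $\mathcal{O_D}$ to abelian groups. Its principal component is $M=\underline M(G/1)$, with the left $\mathbb Z[G]$-module structure in which $g\in G$ acts by $\underline M(r_g)$, where $r_g(a)=ag$ on $G/1=G$. Tensor products of $\mathcal{O_D}$-modules are taken over $\mathbb Z$, objectwise. Let $\underline{\mathbb Z}$ be the constant $\mathcal{O_D}$-module with value $\mathbb Z$. Regard $\pi$ as a left $G$-set via $(x,y)\cdot g=xgy^{-1}$. Let $\underline M_\pi(G/H)=\mathbb Z[\mathrm{Map}_G(G/H,\pi)]\ (=\mathbb Z[\pi^H])$, let $\epsilon:\underline M_\pi\to\underline{\mathbb Z}$ be the augmentation (every basis element goes to $1$), let $i:\underline I\to\underline M_\pi$ be the inclusion of its kernel, and let $\underline I^n=\underline I\otimes\dots\otimes\underline I$ ($n$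 factors, $\underline I^0=\underline{\mathbb Z}$). The principal component of $\underline I^n$ is $I^n=I\otimes_{\mathbb Z}\dots\otimes_{\mathbb Z} I$ with the diagonal action, where $I=\ker(\mathbb Z[\pi]\to\mathbb Z)$ is the augmentation ideal with the $G$-action $(x,y)\cdot g=xgy^{-1}$. Splicing the sequences $$0\to\underline I^{r}\xrightarrow{\,i\otimes 1\,}\underline M_\pi\otimes\underline I^{r-1}\xrightarrow{\,\epsilon\otimes 1\,}\underline I^{r-1}\to 0,\qquad 1\le r\le n,$$ gives $$(\ast)\qquad 0\to\underline I^n\to\underline M_\pi\otimes\underline I^{n-1}\to\dots\to\underline M_\pi\otimes\underline I\to\underline M_\pi\to\underline{\mathbb Z}\to 0 .$$ Let $\underline P_\ast\to\underline{\mathbb Z}$ be a projective resolution by $\mathcal{O_D}$-modules and put $H^n_{\mathcal D}(G;\underline M)=H^n(\mathrm{Hom}_{\mathcal{O_D}}(\underline P_\ast,\underline M))$ (Bredon cohomology). Let $$\Phi:H^n_{\mathcal D}(G;\underline M)\to H^n(G;M)$$ be the homomorphism which restricts cochains to principal components and composes them with a $\mathbb Z[G]$-chain map, over the identity of $\mathbb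 Z$, from the bar resolution of $\mathbb Z$ to $\underline P_\ast(G/1)$. Lift the identity of $\underline{\mathbb Z}$ to a chain map from $\underline P_\ast$ to $(\ast)$, with component $f:\underline P_n\to\underline I^n$ in degree $n$. The $n$-th power $\mathfrak u^n\in H^n_{\mathcal D}(G;\underline I^n)$ of the Bredon canonical class is the class of the cocycle $f$. Let $\mathfrak v\in H^1(G;I)$ be the ordinary canonical class, that is, the class of the crossed homomorphism $(x,y)\mapsto xy^{-1}-1$. Let $\mathfrak v^n\in H^n(G;I^n)$ be its $n$-fold cup power. Here, for inhomogeneous cochains of degrees $p$ and $q$, the cup product is $(a\cup b)(g_1,\dots,g_{p+q})=a(g_1,\dots,g_p)\otimes g_1\cdots g_p\,b(g_{p+1},\dots,g_{p+q})$. **Theorem.** For every integer $n\ge 1$, such chain maps $\underline P_\ast\to(\ast)$ exist and the class $\mathfrak u^n$ does not depend on the choice of the chain map; and for every choice of $\underline P_\ast$ and of the comparison chain map that defines $\Phi$, $$\Phi(\mathfrak u^n)=\mathfrak v^n=\mathfrak v\cup\dots\cup\mathfrak v\in H^n(\pi\times\pi;I^n).$$ -/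

import Mathlib

open CategoryTheory MonoidalCategory
open scoped TensorProduct

universe u

noncomputable section

namespace BredonTC

section Cup

variable {k G : Type u} [CommRing k] [Group G]

/-- The cup product of inhomogeneous cochains,
`(a ∪ b)(g₁, …, gₙ) = a(g₁, …, g_p) ⊗ g₁ ⋯ g_p b(g_{p+1}, …, gₙ)` for `n = p + q`. -/
def cupCochain {A B : Rep.{u} k G} {p q n : ℕ} (h : p + q = n)
    (a : (Fin p → G) → A) (b : (Fin q → G) → B) : (Fin n → G) → (A ⊗ B : Rep.{u} k G) := fun g =>
  a (fun i => g ⟨i, by omega⟩) ⊗ₜ[k]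
    B.ρ (Fin.partialProd g ⟨p, by omega⟩) (b fun j => g ⟨p + j, by omega⟩)

open groupCohomology

lemma cupCochain_contractNth_left {A B : Rep.{u} k G} {p q : ℕ}
    (a : (Fin p → G) → A) (b : (Fin q → G) → B) (g : Fin (p + q + 1) → G) (i : Fin p) :
    cupCochain rfl a b (Fin.contractNth ⟨i, by omega⟩ (· * ·) g) =
      a (Fin.contractNth i.castSucc (· * ·) fun j : Fin (p + 1) => g ⟨j, by omega⟩) ⊗ₜ[k]
        B.ρ (Fin.partialProd g ⟨p + 1, by omega⟩) (b fun j => g ⟨p + 1 + j, by omega⟩) := by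
  unfold cupCochain
  congr 2
  · congr 1
    rw [Fin.partialProd_contractNth]
    simp only [Function.comp_apply]
    rw [Fin.succAbove_of_le_castSucc _ _ (by simp [Fin.le_def])]
    rfl
  · congr 1
    funext j
    rw [Fin.contractNth_apply_of_gt _ _ _ _ (by simp; omega)]
    congr 1
    ext
    simp; omega

lemma cupCochain_contractNth_right {A B : Rep.{u} k G} {p q : ℕ}
    (a : (Fin p → G) → A) (b : (Fin q → G) → B) (g : Fin (p + q + 1) → G) (j : Fin (q + 1)) :
    cupCochain rfl a b (Fin.contractNth ⟨p + j, by omega⟩ (· * ·) g) =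
      a (fun i => g ⟨i, by omega⟩) ⊗ₜ[k]
        B.ρ (Fin.partialProd g ⟨p, by omega⟩)
          (b (Fin.contractNth j (· * ·) fun i : Fin (q + 1) => g ⟨p + i, by omega⟩)) := by
  unfold cupCochain
  congr 2
  · funext i
    rw [Fin.contractNth_apply_of_lt _ _ _ _ (by simp; omega)]
    rfl
  · rw [Fin.partialProd_contractNth]
    simp only [Function.comp_apply]
    rw [Fin.succAbove_of_castSucc_lt _ _ (by simp [Fin.lt_def])]
    rfl
  · congr 1
    funext i
    rcases lt_trichotomy (i : ℕ) j with h | h | h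
    · rw [Fin.contractNth_apply_of_lt _ _ _ _ (by simp; omega),
        Fin.contractNth_apply_of_lt _ _ _ _ h]
      rfl
    · rw [Fin.contractNth_apply_of_eq _ _ _ _ (by simp; omega),
        Fin.contractNth_apply_of_eq _ _ _ _ h]
      rfl
    · rw [Fin.contractNth_apply_of_gt _ _ _ _ (by simp; omega),
        Fin.contractNth_apply_of_gt _ _ _ _ h]
      rfl

lemma d_cupCochain {A B : Rep.{u} k G} {p q n : ℕ} (h : p + q = n)
    (a : (Fin p → G) → A) (b : (Fin q → G) → B) :
    inhomogeneousCochains.d (A ⊗ B) n (cupCochain h a b) =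
      cupCochain (show (p + 1) + q = n + 1 by omega) (inhomogeneousCochains.d A p a) b +
      (-1 : k) ^ p • cupCochain (show p + (q + 1) = n + 1 by omega) a
        (inhomogeneousCochains.d B q b) := by
  subst h
  funext g
  have h0 : (A ⊗ B : Rep k G).ρ (g 0) (cupCochain rfl a b fun i => g i.succ) =
      A.ρ (g 0) (a fun i => g ⟨i + 1, by omega⟩) ⊗ₜ[k]
        B.ρ (Fin.partialProd g ⟨p + 1, by omega⟩) (b fun j => g ⟨p + 1 + j, by omega⟩) := by
    have e : Fin.partialProd g ⟨p + 1, by omega⟩ =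
        g 0 * Fin.partialProd (fun i : Fin (p + q) => g i.succ) ⟨p, by omega⟩ :=
      Fin.partialProd_succ' g ⟨p, by omega⟩
    have e2 : (fun j : Fin q => g ⟨p + 1 + j, by omega⟩) =
        fun j : Fin q => g (Fin.succ ⟨p + j, by omega⟩) := by
      funext j; congr 1; ext; simp; omega
    rw [e, e2, map_mul]
    rfl
  have s1 : ∀ F : Fin (p + q + 1) → (A.V ⊗[k] B.V), ∑ j, F j =
      ∑ i : Fin p, F ⟨i, by omega⟩ + ∑ j : Fin (q + 1), F ⟨p + j, by omega⟩ := fun F =>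
    Fin.sum_univ_add (a := p) (b := q + 1) F
  have hl : inhomogeneousCochains.d (A ⊗ B) (p + q) (cupCochain rfl a b) g =
      (A ⊗ B : Rep k G).ρ (g 0) (cupCochain rfl a b fun i => g i.succ) +
      (∑ i : Fin p, (-1 : k) ^ ((i : ℕ) + 1) •
        cupCochain rfl a b (Fin.contractNth ⟨i, by omega⟩ (· * ·) g) +
       ∑ j : Fin (q + 1), (-1 : k) ^ (p + (j : ℕ) + 1) •
        cupCochain rfl a b (Fin.contractNth ⟨p + j, by omega⟩ (· * ·) g)) :=
    congrArg (fun t => (A ⊗ B : Rep k G).ρ (g 0) (cupCochain rfl a b fun i => g i.succ) + t)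
      (s1 fun j => (-1 : k) ^ ((j : ℕ) + 1) •
        cupCochain rfl a b (Fin.contractNth j (· * ·) g))
  rw [hl, h0]
  simp only [cupCochain_contractNth_left, cupCochain_contractNth_right]
  rw [Pi.add_apply, Pi.smul_apply]
  unfold cupCochain
  simp only [inhomogeneousCochains.d_hom_apply]
  rw [Fin.sum_univ_castSucc (n := p)]
  have e1 : Fin.contractNth (Fin.last p) (· * ·) (fun i : Fin (p + 1) => g ⟨i, by omega⟩) =
      fun i : Fin p => g ⟨i, by omega⟩ := by
    funext i
    rw [Fin.contractNth_apply_of_lt _ _ _ _ (by simp)]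
    rfl
  have e3 : B.ρ (Fin.partialProd g ⟨p + 1, by omega⟩) (b fun j => g ⟨p + 1 + j, by omega⟩) =
      B.ρ (Fin.partialProd g ⟨p, by omega⟩) (B.ρ (g ⟨p, by omega⟩)
        (b fun j => g ⟨p + (j + 1), by omega⟩)) := by
    have e : Fin.partialProd g ⟨p + 1, by omega⟩ =
        Fin.partialProd g ⟨p, by omega⟩ * g ⟨p, by omega⟩ :=
      Fin.partialProd_succ g ⟨p, by omega⟩
    have e2 : (fun j : Fin q => g ⟨p + 1 + j, by omega⟩) =
        fun j : Fin q => g ⟨p + (j + 1), by omega⟩ := by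
      funext j; congr 1; ext; simp; omega
    rw [e, e2, map_mul]
    rfl
  have sg : ∀ j : ℕ, (-1 : k) ^ (p + j + 1) = (-1) ^ p * (-1) ^ (j + 1) := fun j => by ring
  simp only [sg, Fin.val_last, Fin.val_castSucc]
  erw [e1]
  simp only [TensorProduct.add_tmul, TensorProduct.sum_tmul, map_add, map_sum, map_smul,
    TensorProduct.tmul_add, TensorProduct.tmul_sum, TensorProduct.tmul_smul,
    ← TensorProduct.smul_tmul', smul_add, Finset.smul_sum, mul_smul]
  simp only [e3]
  have fin : ∀ T S S₂ Y : A.V ⊗[k] B.V, T + (S + S₂) =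
      T + (S + (-1 : k) ^ (p + 1) • Y) + ((-1 : k) ^ p • Y + S₂) := fun T S S₂ Y => by
    rw [pow_succ, mul_neg_one, neg_smul]; abel
  exact fin _ _ _ _

lemma cupCochain_add_left {A B : Rep.{u} k G} {p q n : ℕ} (h : p + q = n)
    (a a' : (Fin p → G) → A) (b : (Fin q → G) → B) :
    cupCochain h (a + a') b = cupCochain h a b + cupCochain h a' b :=
  funext fun _ => TensorProduct.add_tmul _ _ _

lemma cupCochain_smul_left {A B : Rep.{u} k G} {p q n : ℕ} (h : p + q = n) (c : k)
    (a : (Fin p → G) → A) (b : (Fin q → G) → B) :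
    cupCochain h (c • a) b = c • cupCochain h a b :=
  funext fun _ => TensorProduct.smul_tmul' _ _ _

lemma cupCochain_add_right {A B : Rep.{u} k G} {p q n : ℕ} (h : p + q = n)
    (a : (Fin p → G) → A) (b b' : (Fin q → G) → B) :
    cupCochain h a (b + b') = cupCochain h a b + cupCochain h a b' :=
  funext fun g => by
    simp only [cupCochain, Pi.add_apply, map_add, TensorProduct.tmul_add]

lemma cupCochain_smul_right {A B : Rep.{u} k G} {p q n : ℕ} (h : p + q = n) (c : k)
    (a : (Fin p → G) → A) (b : (Fin q → G) → B) :
    cupCochain h a (c • b) = c • cupCochain h a b :=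
  funext fun g => by
    simp only [cupCochain, Pi.smul_apply, map_smul, TensorProduct.tmul_smul]

lemma cupCochain_zero_left {A B : Rep.{u} k G} {p q n : ℕ} (h : p + q = n)
    (b : (Fin q → G) → B) : cupCochain h (0 : (Fin p → G) → A) b = 0 :=
  funext fun _ => TensorProduct.zero_tmul _ _

lemma cupCochain_zero_right {A B : Rep.{u} k G} {p q n : ℕ} (h : p + q = n)
    (a : (Fin p → G) → A) : cupCochain h a (0 : (Fin q → G) → B) = 0 :=
  funext fun g => by
    simp only [cupCochain, Pi.zero_apply, map_zero, TensorProduct.tmul_zero]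

lemma d_iCocycles {A : Rep.{u} k G} {n : ℕ} (a : cocycles A n) :
    inhomogeneousCochains.d A n (iCocycles A n a) = 0 := by
  have h : iCocycles A n ≫ (inhomogeneousCochains A).d n (n + 1) = 0 :=
    HomologicalComplex.iCycles_d _ _ _
  rw [inhomogeneousCochains.d_def] at h
  exact congrArg (fun f => f.hom a) h

lemma iCocycles_injective (A : Rep.{u} k G) (n : ℕ) : Function.Injective (iCocycles A n) := by
  have : Mono (iCocycles A n) := by unfold iCocycles; infer_instance
  exact (ModuleCat.mono_iff_injective _).1 this

lemma π_surjective (A : Rep.{u} k G) (n : ℕ) : Function.Surjective (π A n) := by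
  have : Epi (π A n) := by unfold π groupCohomology; infer_instance
  exact (ModuleCat.epi_iff_surjective _).1 this

lemma d_cupCochain_iCocycles {A B : Rep.{u} k G} {p q n : ℕ} (h : p + q = n)
    (a : cocycles A p) (b : cocycles B q) :
    inhomogeneousCochains.d (A ⊗ B) n
      (cupCochain h (iCocycles A p a) (iCocycles B q b)) = 0 := by
  rw [d_cupCochain, d_iCocycles, d_iCocycles, cupCochain_zero_left, cupCochain_zero_right,
    smul_zero, add_zero]

/-- The cup product of two cocycles, as a cocycle. -/
def cupCocycle {A B : Rep.{u} k G} {p q n : ℕ} (h : p + q = n)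
    (a : cocycles A p) (b : cocycles B q) : cocycles (A ⊗ B) n :=
  cocyclesMk (cupCochain h (iCocycles A p a) (iCocycles B q b)) (d_cupCochain_iCocycles h a b)

lemma iCocycles_cupCocycle {A B : Rep.{u} k G} {p q n : ℕ} (h : p + q = n)
    (a : cocycles A p) (b : cocycles B q) :
    iCocycles (A ⊗ B) n (cupCocycle h a b) = cupCochain h (iCocycles A p a) (iCocycles B q b) :=
  iCocycles_mk _ (d_cupCochain_iCocycles h a b)

lemma π_eq_zero_of_eq_d {A : Rep.{u} k G} {n : ℕ} (a : cocycles A (n + 1))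
    (c : (Fin n → G) → A) (hc : iCocycles A (n + 1) a = inhomogeneousCochains.d A n c) :
    π A (n + 1) a = 0 := by
  have e : a = toCocycles A n (n + 1) c := by
    apply iCocycles_injective
    rw [hc]
    have := HomologicalComplex.toCycles_i (inhomogeneousCochains A) n (n + 1)
    rw [inhomogeneousCochains.d_def] at this
    exact (congrArg (fun f => f.hom c) this).symm
  rw [e]
  exact congrArg (fun f => f.hom c)
    (HomologicalComplex.toCycles_comp_homologyπ (inhomogeneousCochains A) n (n + 1))

lemma exists_toCocycles_of_π_eq_zero {A : Rep.{u} k G} {n : ℕ} (a : cocycles A n)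
    (ha : π A n a = 0) :
    ∃ c : (inhomogeneousCochains A).X ((ComplexShape.up ℕ).prev n),
      (inhomogeneousCochains A).d _ n c = iCocycles A n a := by
  have hex := ShortComplex.exact_of_g_is_cokernel
    (ShortComplex.mk _ _ ((inhomogeneousCochains A).toCycles_comp_homologyπ
      ((ComplexShape.up ℕ).prev n) n)) ((inhomogeneousCochains A).homologyIsCokernel _ n rfl)
  obtain ⟨c, hc⟩ := (ShortComplex.moduleCat_exact_iff _).1 hex a ha
  refine ⟨c, ?_⟩
  have := HomologicalComplex.toCycles_i (inhomogeneousCochains A) ((ComplexShape.up ℕ).prev n) n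
  rw [← this, ← hc]
  rfl

lemma eq_zero_of_π_eq_zero {A : Rep.{u} k G} (a : cocycles A 0) (ha : π A 0 a = 0) : a = 0 := by
  obtain ⟨c, hc⟩ := exists_toCocycles_of_π_eq_zero a ha
  apply iCocycles_injective
  rw [← hc, (inhomogeneousCochains A).shape _ _ (by simp)]
  simp

lemma exists_d_of_π_eq_zero {A : Rep.{u} k G} {n : ℕ} (a : cocycles A (n + 1))
    (ha : π A (n + 1) a = 0) :
    ∃ c : (Fin n → G) → A, inhomogeneousCochains.d A n c = iCocycles A (n + 1) a := by
  have h := exists_toCocycles_of_π_eq_zero a ha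
  rw [CochainComplex.prev_nat_succ] at h
  obtain ⟨c, hc⟩ := h
  rw [inhomogeneousCochains.d_def] at hc
  exact ⟨c, hc⟩

lemma π_cupCocycle_eq_zero_left {A B : Rep.{u} k G} {p q n : ℕ} (h : p + q = n)
    (a : cocycles A p) (b : cocycles B q) (ha : π A p a = 0) :
    π (A ⊗ B) n (cupCocycle h a b) = 0 := by
  obtain _ | p := p
  · rw [eq_zero_of_π_eq_zero a ha]
    have : cupCocycle h (0 : cocycles A 0) b = 0 := by
      apply iCocycles_injective
      rw [iCocycles_cupCocycle, map_zero, map_zero]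
      exact cupCochain_zero_left _ _
    rw [this, map_zero]
  · obtain ⟨c, hc⟩ := exists_d_of_π_eq_zero a ha
    obtain ⟨m, rfl⟩ : ∃ m, n = m + 1 := ⟨p + q, by omega⟩
    refine π_eq_zero_of_eq_d _ (cupCochain (show p + q = m by omega) c (iCocycles B q b)) ?_
    rw [iCocycles_cupCocycle, d_cupCochain, ← hc, d_iCocycles, cupCochain_zero_right, smul_zero,
      add_zero]

lemma π_cupCocycle_eq_zero_right {A B : Rep.{u} k G} {p q n : ℕ} (h : p + q = n)
    (a : cocycles A p) (b : cocycles B q) (hb : π B q b = 0) :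
    π (A ⊗ B) n (cupCocycle h a b) = 0 := by
  obtain _ | q := q
  · rw [eq_zero_of_π_eq_zero b hb]
    have : cupCocycle h a (0 : cocycles B 0) = 0 := by
      apply iCocycles_injective
      rw [iCocycles_cupCocycle, map_zero, map_zero]
      exact cupCochain_zero_right _ _
    rw [this, map_zero]
  · obtain ⟨c, hc⟩ := exists_d_of_π_eq_zero b hb
    obtain ⟨m, rfl⟩ : ∃ m, n = m + 1 := ⟨p + q, by omega⟩
    refine π_eq_zero_of_eq_d _
      ((-1 : k) ^ p • cupCochain (show p + q = m by omega) (iCocycles A p a) c) ?_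
    rw [iCocycles_cupCocycle, map_smul, d_cupCochain, ← hc, d_iCocycles, smul_add, smul_smul,
      ← mul_pow, neg_one_mul, neg_neg, one_pow, one_smul,
      cupCochain_zero_left, smul_zero, zero_add]

lemma cupCocycle_add_left {A B : Rep.{u} k G} {p q n : ℕ} (h : p + q = n)
    (a a' : cocycles A p) (b : cocycles B q) :
    cupCocycle h (a + a') b = cupCocycle h a b + cupCocycle h a' b := by
  apply iCocycles_injective
  have e : iCocycles (A ⊗ B) n (cupCocycle h a b + cupCocycle h a' b) = _ + _ := map_add _ _ _
  rw [e, iCocycles_cupCocycle, iCocycles_cupCocycle, iCocycles_cupCocycle, ← cupCochain_add_left]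
  congr 1
  exact map_add _ _ _

lemma cupCocycle_add_right {A B : Rep.{u} k G} {p q n : ℕ} (h : p + q = n)
    (a : cocycles A p) (b b' : cocycles B q) :
    cupCocycle h a (b + b') = cupCocycle h a b + cupCocycle h a b' := by
  apply iCocycles_injective
  have e : iCocycles (A ⊗ B) n (cupCocycle h a b + cupCocycle h a b') = _ + _ := map_add _ _ _
  rw [e, iCocycles_cupCocycle, iCocycles_cupCocycle, iCocycles_cupCocycle, ← cupCochain_add_right]
  congr 1
  exact map_add _ _ _

lemma π_cupCocycle_congr {A B : Rep.{u} k G} {p q n : ℕ} (h : p + q = n)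
    {a a' : cocycles A p} {b b' : cocycles B q} (ha : π A p a = π A p a')
    (hb : π B q b = π B q b') :
    π (A ⊗ B) n (cupCocycle h a b) = π (A ⊗ B) n (cupCocycle h a' b') := by
  have h₁ : cupCocycle h a b = cupCocycle h a' b + cupCocycle h (a - a') b := by
    rw [← cupCocycle_add_left]; congr 1; abel
  have h₂ : cupCocycle h a' b = cupCocycle h a' b' + cupCocycle h a' (b - b') := by
    rw [← cupCocycle_add_right]; congr 1; abel
  have e₁ : π A p (a - a') = 0 := (map_sub _ _ _).trans (sub_eq_zero.2 ha)
  have e₂ : π B q (b - b') = 0 := (map_sub _ _ _).trans (sub_eq_zero.2 hb)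
  rw [h₁, h₂]
  refine (map_add _ _ _).trans ?_
  rw [π_cupCocycle_eq_zero_left h _ _ e₁, add_zero]
  refine (map_add _ _ _).trans ?_
  rw [π_cupCocycle_eq_zero_right h _ _ e₂, add_zero]

/-- The cup product `Hᵖ(G, A) × H^q(G, B) → Hⁿ(G, A ⊗ B)`, `p + q = n`, induced by the cup product
of cocycles (it does not depend on the representatives: `cup_π_π`). -/
def cup {A B : Rep.{u} k G} {p q n : ℕ} (h : p + q = n)
    (x : groupCohomology A p) (y : groupCohomology B q) : groupCohomology (A ⊗ B) n :=
  π (A ⊗ B) n (cupCocycle h (π_surjective A p x).choose (π_surjective B q y).choose)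

lemma cup_π_π {A B : Rep.{u} k G} {p q n : ℕ} (h : p + q = n)
    (a : cocycles A p) (b : cocycles B q) :
    cup h (π A p a) (π B q b) = π (A ⊗ B) n (cupCocycle h a b) :=
  π_cupCocycle_congr h (π_surjective A p _).choose_spec (π_surjective B q _).choose_spec

end Cup

section Orbit

variable (k : Type u) [CommRing k] (π : Type u) [Group π]

/-- The family `D` of subgroups of `G = π × π`: the smallest family that contains the diagonal and the
trivial subgroup and is closed under conjugation and under finite intersections. -/
inductive IsInD : Subgroup (π × π) → Prop
  | diag : IsInD ((MonoidHom.fst π π).eqLocus (MonoidHom.snd π π))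
  | bot : IsInD ⊥
  | conj (g : π × π) (H : Subgroup (π × π)) :
      IsInD H → IsInD (H.map (MulAut.conj g).toMonoidHom)
  | inf (H K : Subgroup (π × π)) : IsInD H → IsInD K → IsInD (H ⊓ K)

/-- The objects of the orbit category of `G = π × π` with respect to the family `D`: the orbits `G ⧸ H`
with `H` in `D`. -/
structure Orb where
  H : Subgroup (π × π)
  mem : IsInD π H

variable {π} in
/-- The left `G`-set `G ⧸ H`. -/
abbrev Orb.quot (O : Orb π) : Type u := (π × π) ⧸ O.H

/-- The morphisms of the orbit category are the `G`-maps `G ⧸ H → G ⧸ K`. -/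
instance : Category.{u} (Orb π) where
  Hom O O' := O.quot →[π × π] O'.quot
  id O := MulActionHom.id (π × π)
  comp f g := g.comp f

/-- The orbit `G ⧸ 1`. -/
def Orb.free : Orb π := ⟨⊥, .bot⟩

variable {π} in
/-- The endomorphism `a ↦ a g` of the orbit `G ⧸ 1`. -/
def Orb.rightTranslation (g : π × π) : Orb.free π ⟶ Orb.free π where
  toFun := Quotient.map' (· * g) fun a b h => by
    rw [QuotientGroup.leftRel_apply] at h ⊢
    have h : a⁻¹ * b = 1 := h
    rw [inv_mul_eq_one.1 h]
    simp
  map_smul' h x := by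
    induction x using Quotient.inductionOn' with
    | h a => exact congrArg (QuotientGroup.mk (s := (⊥ : Subgroup (π × π)))) (mul_assoc h a g)

/-- The category of right modules over the orbit category: contravariant functors to `k`-modules.
Its monoidal structure is the objectwise tensor product; the unit `𝟙_` is the constant functor `k`. -/
abbrev BredonModule := (Orb π)ᵒᵖ ⥤ ModuleCat.{u} k

variable {π} in
lemma Orb.free_quot_ext {O : Orb π} {f g : (Orb.free π) ⟶ O}
    (h : f.toFun (QuotientGroup.mk 1) = g.toFun (QuotientGroup.mk 1)) : f = g := by
  apply MulActionHom.ext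
  intro x
  induction x using Quotient.inductionOn' with
  | h a =>
    have e : (Quotient.mk'' a : (Orb.free π).quot) = a • QuotientGroup.mk 1 := by
      exact congrArg (QuotientGroup.mk (s := (⊥ : Subgroup (π × π)))) (mul_one a).symm
    rw [e]
    exact (f.map_smul' _ _).trans ((congrArg (a • ·) h).trans (g.map_smul' _ _).symm)

lemma Orb.rightTranslation_one : Orb.rightTranslation (1 : π × π) = 𝟙 _ :=
  Orb.free_quot_ext (congrArg (QuotientGroup.mk (s := (⊥ : Subgroup (π × π)))) (mul_one 1))

variable {π} in
lemma Orb.rightTranslation_mul (g h : π × π) :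
    Orb.rightTranslation (g * h) = Orb.rightTranslation g ≫ Orb.rightTranslation h :=
  Orb.free_quot_ext
    (congrArg (QuotientGroup.mk (s := (⊥ : Subgroup (π × π)))) (mul_assoc 1 g h).symm)

variable {k π} in
/-- The action of `G` on `M (G ⧸ 1)` by the right translations of `G ⧸ 1`. -/
def principalRho (M : BredonModule k π) :
    Representation k (π × π) (M.obj (.op (Orb.free π))) where
  toFun g := (M.map (Orb.rightTranslation g).op).hom
  map_one' := by
    rw [Orb.rightTranslation_one, op_id, M.map_id]
    rfl
  map_mul' g h := by
    rw [Orb.rightTranslation_mul, op_comp, M.map_comp]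
    rfl

/-- The principal component `M (G ⧸ 1)` of a module `M` over the orbit category, as a `k[G]`-module. -/
def principal : BredonModule k π ⥤ Rep.{u} k (π × π) where
  obj M := Rep.of (principalRho M)
  map {M N} f := Rep.ofHom
    { toLinearMap := (f.app (.op (Orb.free π))).hom
      isIntertwining' := fun g =>
        congrArg ModuleCat.Hom.hom (f.naturality (Orb.rightTranslation g).op) }

instance : (principal k π).Additive where
instance : (principal k π).Linear k where

/-- The module `G ⧸ H ↦ k[Hom_G(G ⧸ H, X)] = k[X^H]` of a `G`-set `X`. -/
def freeMod (X : Type u) [MulAction (π × π) X] : BredonModule k π where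
  obj O := ModuleCat.of k ((O.unop.quot →[π × π] X) →₀ k)
  map f := ModuleCat.ofHom (Finsupp.lmapDomain k k fun φ => φ.comp f.unop)
  map_id O := by
    ext : 1
    exact Finsupp.lmapDomain_id k k
  map_comp {O₁ O₂ O₃} f g := by
    ext : 1
    exact Finsupp.lmapDomain_comp k k (fun φ : O₁.unop.quot →[π × π] X => φ.comp f.unop)
      fun φ => φ.comp g.unop

/-- The augmentation `k[Hom_G(?, X)] → k`, which sends every basis element to `1`. -/
def augmentation (X : Type u) [MulAction (π × π) X] :
    freeMod k π X ⟶ 𝟙_ (BredonModule k π) where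
  app O := ModuleCat.ofHom (Finsupp.linearCombination k fun _ => (1 : k))
  naturality O O' f := by
    ext : 1
    refine Finsupp.lhom_ext fun φ r => ?_
    change Finsupp.linearCombination k _ (Finsupp.mapDomain _ (Finsupp.single φ r)) =
      Finsupp.linearCombination k (fun _ => (1 : k)) (Finsupp.single φ r)
    rw [Finsupp.mapDomain_single]
    simp

/-- The kernel of the augmentation, objectwise. -/
def augKer (X : Type u) [MulAction (π × π) X] : BredonModule k π where
  obj O := ModuleCat.of k (LinearMap.ker ((augmentation k π X).app O).hom)
  map {O O'} f := ModuleCat.ofHom (LinearMap.restrict ((freeMod k π X).map f).hom (by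
    intro x hx
    have h := congrArg (fun t => ModuleCat.Hom.hom t x) ((augmentation k π X).naturality f)
    exact h.trans hx))
  map_id O := by
    ext x : 2
    exact Subtype.ext (congrArg (fun t => ModuleCat.Hom.hom t x.1) ((freeMod k π X).map_id O))
  map_comp f g := by
    ext x : 2
    exact Subtype.ext
      (congrArg (fun t => ModuleCat.Hom.hom t x.1) ((freeMod k π X).map_comp f g))

/-- The inclusion of the kernel of the augmentation. -/
def augKerι (X : Type u) [MulAction (π × π) X] : augKer k π X ⟶ freeMod k π X where
  app O := ModuleCat.ofHom (Submodule.subtype _)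

/-- The group `π`, regarded as a left `G`-set (`G = π × π`) by `(x, y) • g = x g y⁻¹`. -/
def TwoSided (π : Type u) : Type u := π

instance : Group (TwoSided π) := inferInstanceAs (Group π)

variable {π} in
/-- An element of `π` as an element of the `G`-set `π`. -/
def TwoSided.of (g : π) : TwoSided π := g

instance : MulAction (π × π) (TwoSided π) where
  smul g x := TwoSided.of g.1 * x * TwoSided.of g.2⁻¹
  one_smul x := by
    change (1 : TwoSided π) * x * TwoSided.of (1 : π)⁻¹ = x
    rw [inv_one]
    exact (mul_one _).trans (one_mul x)
  mul_smul g h x := by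
    have key : ∀ a b c d y : π, a * b * y * (c * d)⁻¹ = a * (b * y * d⁻¹) * c⁻¹ := by
      intros; simp only [mul_inv_rev, mul_assoc]
    exact key _ _ _ _ x

/-- The Bredon augmentation ideal: the kernel of the augmentation of the module of the `G`-set `π`. -/
abbrev bredonI : BredonModule k π := augKer k π (TwoSided π)

/-- The tensor powers of the Bredon augmentation ideal `I`: `k, I, I ⊗ I, I ⊗ (I ⊗ I), …`. -/
def bredonIPow : ℕ → BredonModule k π
  | 0 => 𝟙_ (BredonModule k π)
  | 1 => bredonI k π
  | n + 2 => bredonI k π ⊗ bredonIPow (n + 1)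

/-- The terms `M ⊗ Iⁿ` (`M` the module of the `G`-set `π`) of the exact sequence
`… → M ⊗ I² → M ⊗ I → M → k → 0`. -/
def bredonC : ℕ → BredonModule k π
  | 0 => freeMod k π (TwoSided π)
  | n + 1 => freeMod k π (TwoSided π) ⊗ bredonIPow k π (n + 1)

/-- The map `ε ⊗ 1 : M ⊗ Iⁿ → k ⊗ Iⁿ = Iⁿ`. -/
def bredonCToIPow : ∀ n : ℕ, bredonC k π n ⟶ bredonIPow k π n
  | 0 => augmentation k π (TwoSided π)
  | n + 1 => augmentation k π (TwoSided π) ▷ bredonIPow k π (n + 1) ≫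
      (λ_ (bredonIPow k π (n + 1))).hom

/-- The map `i ⊗ 1 : Iⁿ⁺¹ = I ⊗ Iⁿ → M ⊗ Iⁿ`, where `i` is the inclusion of `I` in `M`. The differential
`M ⊗ Iⁿ⁺¹ → M ⊗ Iⁿ` of the exact sequence is `ε ⊗ 1` followed by this map. -/
def bredonIPowToC : ∀ n : ℕ, bredonIPow k π (n + 1) ⟶ bredonC k π n
  | 0 => augKerι k π (TwoSided π)
  | n + 1 => augKerι k π (TwoSided π) ▷ bredonIPow k π (n + 1)

section Cohomology

variable {k π}
variable (P : ProjectiveResolution (𝟙_ (BredonModule k π))) (M : BredonModule k π) (n : ℕ)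

/-- Bredon cohomology: the cohomology of the complex `Hom(P, M)`, where `P` is a projective resolution
of the constant module `k` over the orbit category. -/
def bredonCohomology : ModuleCat.{u} k := (P.complex.linearYonedaObj k M).homology n

/-- The class in Bredon cohomology of an `n`-cocycle `f : P n → M`. -/
def bredonClass (f : P.complex.X n ⟶ M) (hf : P.complex.d (n + 1) n ≫ f = 0) :
    bredonCohomology P M n :=
  (P.complex.linearYonedaObj k M).homologyπ n
    ((P.complex.linearYonedaObj k M).cyclesMk f (n + 1) (by simp) hf)

/-- The augmentation `P 0 → k` of the resolution. -/
def bredonAug : P.complex.X 0 ⟶ 𝟙_ (BredonModule k π) := P.π.f 0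

variable (k π) in
/-- The augmentation of the bar resolution of `k` over `k[G]`. -/
def barAug : (Rep.barComplex k (π × π)).X 0 ⟶ Rep.trivial k (π × π) k :=
  (Rep.barResolution k (π × π)).π.f 0

/-- A lift of the identity of `k` to a chain map from `P` to the exact sequence
`0 → Iⁿ → M ⊗ Iⁿ⁻¹ → … → M ⊗ I → M → k → 0`: maps `φ i : P i → M ⊗ Iⁱ` for `i < n` and
`z n : P n → Iⁿ`. The sequence is spliced from `0 → Iⁱ⁺¹ → M ⊗ Iⁱ → Iⁱ → 0`; correspondingly
`z i : P i → Iⁱ` is the composite of `φ i` and `M ⊗ Iⁱ → Iⁱ`, with `z 0` the augmentation, and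
`z (i + 1)` is the factorization of `φ i ∘ d` through `Iⁱ⁺¹ → M ⊗ Iⁱ`. The last condition says that
`z n` vanishes on boundaries. (The values of `φ` at `i ≥ n` and of `z` at `i > n` play no role.) -/
structure CanonicalPowerDiagram where
  φ : ∀ i, P.complex.X i ⟶ bredonC k π i
  z : ∀ i, P.complex.X i ⟶ bredonIPow k π i
  z_zero : z 0 = bredonAug P
  φ_comp : ∀ i < n, φ i ≫ bredonCToIPow k π i = z i
  z_comp : ∀ i < n, z (i + 1) ≫ bredonIPowToC k π i = P.complex.d (i + 1) i ≫ φ i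
  cocycle : P.complex.d (n + 1) n ≫ z n = 0

/-- `c` is a value of the `n`-th power `uⁿ` of the Bredon canonical class: the class of the cocycle
`z n : P n → Iⁿ` for a chain map that lifts the identity of `k`. -/
def IsCanonicalPower (c : bredonCohomology P (bredonIPow k π n) n) : Prop :=
  ∃ D : CanonicalPowerDiagram P n, c = bredonClass P (bredonIPow k π n) n (D.z n) D.cocycle

/-- The principal component of the constant module is the trivial `k[G]`-module `k`. -/
def principalUnit : (principal k π).obj (𝟙_ (BredonModule k π)) ≅ Rep.trivial k (π × π) k :=
  Rep.mkIso (.mk (LinearEquiv.refl k k) fun _ => rfl)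

/-- A chain map over `k` from the bar resolution of `k` over `k[G]` to the principal component `P(G ⧸ 1)`
of the resolution `P`. (It is unique up to chain homotopy.) -/
structure PrincipalComparison where
  f : ∀ i, (Rep.barComplex k (π × π)).X i ⟶ (principal k π).obj (P.complex.X i)
  comm : ∀ i, f (i + 1) ≫ (principal k π).map (P.complex.d (i + 1) i) =
    (Rep.barComplex k (π × π)).d (i + 1) i ≫ f i
  comm_augmentation : f 0 ≫ (principal k π).map (bredonAug P) ≫ principalUnit.hom =
    barAug k π

variable {P}

/-- The map `Hom(P, M) → Hom_G(bar, M(G ⧸ 1))`: evaluate at `G ⧸ 1` and compose with the comparison. -/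
def principalCochainMap (θ : PrincipalComparison P) :
    P.complex.linearYonedaObj k M ⟶
      (Rep.barComplex k (π × π)).linearYonedaObj k ((principal k π).obj M) where
  f i := ModuleCat.ofHom
    { toFun := fun f : P.complex.X i ⟶ M => θ.f i ≫ (principal k π).map f
      map_add' := fun f g => by
        rw [Functor.map_add, Preadditive.comp_add]
      map_smul' := fun r f => by
        rw [Functor.map_smul, Linear.comp_smul]
        rfl }
  comm' i j hij := by
    obtain rfl : i + 1 = j := hij
    ext (f : P.complex.X i ⟶ M)
    change (Rep.barComplex k (π × π)).d (i + 1) i ≫ θ.f i ≫ (principal k π).map f =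
      θ.f (i + 1) ≫ (principal k π).map (P.complex.d (i + 1) i ≫ f)
    rw [Functor.map_comp, ← Category.assoc, ← Category.assoc, θ.comm]

/-- The homomorphism `Φ` from Bredon cohomology to the cohomology of the group `G = π × π` with
coefficients in the principal component of `M`. -/
def Phi (θ : PrincipalComparison P) :
    bredonCohomology P M n ⟶ groupCohomology ((principal k π).obj M) n :=
  HomologicalComplex.homologyMap (principalCochainMap M θ ≫
    (groupCohomology.inhomogeneousCochainsIso ((principal k π).obj M)).inv) n

end Cohomology

/-- The permutation representation `k[X]` of a `G`-set `X`. -/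
def permRep (G : Type u) [Group G] (X : Type u) [MulAction G X] :
    Representation k G (X →₀ k) where
  toFun g := Finsupp.lmapDomain k k (g • ·)
  map_one' := by
    refine Finsupp.lhom_ext fun x r => ?_
    simp
  map_mul' g h := by
    refine Finsupp.lhom_ext fun x r => ?_
    simp [mul_smul]

/-- The augmentation ideal of `k[π]`, the kernel of `∑ n_g g ↦ ∑ n_g`, as a module over `π × π` with
`(x, y) • ∑ n_g g = ∑ n_g x g y⁻¹`. -/
def augIdeal : Rep.{u} k (π × π) :=
  Rep.of (X := LinearMap.ker
      (Finsupp.linearCombination k fun _ : TwoSided π => (1 : k)))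
    { toFun := fun g => (permRep k (π × π) (TwoSided π) g).restrict fun x hx => by
        rw [LinearMap.mem_ker] at hx ⊢
        rw [← hx]
        change Finsupp.linearCombination k _ (Finsupp.mapDomain _ x) = _
        rw [Finsupp.linearCombination_mapDomain]
        rfl
      map_one' := by
        ext x : 1
        exact Subtype.ext (by simp)
      map_mul' := fun g h => by
        ext x : 1
        exact Subtype.ext (by simp) }

/-- The tensor powers of the augmentation ideal, with the diagonal action of `π × π`. -/
def augPow : ℕ → Rep.{u} k (π × π)
  | 0 => Rep.trivial k (π × π) k
  | 1 => augIdeal k π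
  | n + 2 => augIdeal k π ⊗ augPow (n + 1)

/-- The crossed homomorphism `(x, y) ↦ x y⁻¹ - 1`. -/
def canonicalCocycle : groupCohomology.cocycles₁ (augIdeal k π) :=
  ⟨fun g => ⟨Finsupp.single (TwoSided.of (g.1 * g.2⁻¹)) 1 - Finsupp.single (TwoSided.of 1) 1, by
    rw [LinearMap.mem_ker, map_sub, Finsupp.linearCombination_single,
      Finsupp.linearCombination_single, sub_self]⟩, by
    refine (groupCohomology.mem_cocycles₁_iff (A := augIdeal k π) _).2 fun g h => ?_
    apply Subtype.ext
    change Finsupp.single _ _ - Finsupp.single _ _ =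
      Finsupp.mapDomain (g • ·) (Finsupp.single (TwoSided.of (h.1 * h.2⁻¹)) (1 : k) -
        Finsupp.single (TwoSided.of 1) 1) + (Finsupp.single _ _ - Finsupp.single _ _)
    have e₁ : g • TwoSided.of (h.1 * h.2⁻¹) = TwoSided.of ((g * h).1 * (g * h).2⁻¹) := by
      change g.1 * (h.1 * h.2⁻¹) * g.2⁻¹ = (g.1 * h.1) * (g.2 * h.2)⁻¹
      simp only [mul_inv_rev, mul_assoc]
    have e₂ : g • TwoSided.of (1 : π) = TwoSided.of (g.1 * g.2⁻¹) := by
      change g.1 * 1 * g.2⁻¹ = g.1 * g.2⁻¹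
      rw [mul_one]
    have e₃ := Finsupp.mapDomain_sub (f := (g • · : TwoSided π → TwoSided π))
      (v₁ := Finsupp.single (TwoSided.of (h.1 * h.2⁻¹)) (1 : k))
      (v₂ := Finsupp.single (TwoSided.of 1) 1)
    rw [e₃, Finsupp.mapDomain_single, Finsupp.mapDomain_single, e₁, e₂]
    abel⟩

/-- The canonical class `v ∈ H¹(π × π; I)`. -/
def canonicalClass : groupCohomology (augIdeal k π) 1 :=
  groupCohomology.H1π (augIdeal k π) (canonicalCocycle k π)

/-- The unit `1 ∈ H⁰(π × π; k)`. -/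
def unitClass : groupCohomology (Rep.trivial k (π × π) k) 0 :=
  groupCohomology.π _ 0 (groupCohomology.cocyclesMk (fun _ => (1 : k)) (by
    ext g
    simp [inhomogeneousCochains.d_hom_apply]
    rfl))

/-- The cup powers `vⁿ ∈ Hⁿ(π × π; Iⁿ)` of the canonical class. -/
def canonicalClassPow : ∀ n : ℕ, groupCohomology (augPow k π n) n
  | 0 => unitClass k π
  | 1 => canonicalClass k π
  | n + 2 => cup (show 1 + (n + 1) = n + 2 by omega) (canonicalClass k π)
      (canonicalClassPow (n + 1))

section PrincipalIso

variable (X : Type u) [MulAction (π × π) X]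

/-- Evaluation at the base point identifies `Hom_G(G ⧸ 1, X)` with `X`. -/
def evalFree : ((Orb.free π).quot →[π × π] X) ≃ X where
  toFun φ := φ (QuotientGroup.mk 1)
  invFun x :=
    { toFun := fun q => Quotient.liftOn' q (· • x) fun a b h => by
        rw [QuotientGroup.leftRel_apply] at h
        have h : a⁻¹ * b = 1 := h
        rw [inv_mul_eq_one.1 h]
      map_smul' := fun g q => by
        induction q using Quotient.inductionOn' with
        | h a => exact mul_smul g a x }
  left_inv φ := by
    apply MulActionHom.ext
    intro q
    induction q using Quotient.inductionOn' with
    | h a =>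
      refine (φ.map_smul' a (QuotientGroup.mk 1)).symm.trans ?_
      exact congrArg φ (congrArg (QuotientGroup.mk (s := (⊥ : Subgroup (π × π)))) (mul_one a))
  right_inv x := one_smul _ x

/-- The principal component of the kernel of `k[Hom_G(?, X)] → k` is the kernel of `k[X] → k`. -/
def principalAugKerLinearEquiv :
    LinearMap.ker ((augmentation k π X).app (.op (Orb.free π))).hom ≃ₗ[k]
      LinearMap.ker (Finsupp.linearCombination k fun _ : X => (1 : k)) :=
  (Finsupp.domLCongr (evalFree π X)).ofSubmodules _ _ (by
    have h : ((augmentation k π X).app (.op (Orb.free π))).hom =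
        (Finsupp.linearCombination k fun _ : X => (1 : k)) ∘ₗ
          (Finsupp.domLCongr (evalFree π X)).toLinearMap := by
      refine Finsupp.lhom_ext fun φ r => ?_
      change Finsupp.linearCombination k (fun _ => (1 : k)) (Finsupp.single φ r) = _
      simp
    refine (congrArg (fun L => Submodule.map
      (Finsupp.domLCongr (R := k) (M := k) (evalFree π X)).toLinearMap (LinearMap.ker L)) h).trans ?_
    exact (congrArg (Submodule.map
      (Finsupp.domLCongr (R := k) (M := k) (evalFree π X)).toLinearMap)
      (LinearMap.ker_comp _ _)).trans
        (Submodule.map_comap_eq_of_surjective (LinearEquiv.surjective _) _))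

end PrincipalIso

/-- The principal component of the Bredon augmentation ideal is the augmentation ideal of `k[π]`. -/
def principalI : (principal k π).obj (bredonI k π) ≅ augIdeal k π :=
  Rep.mkIso (.mk (principalAugKerLinearEquiv k π (TwoSided π)) fun g => by
    have key : ∀ y : ((Orb.free π).quot →[π × π] TwoSided π) →₀ k,
        Finsupp.equivMapDomain (evalFree π (TwoSided π)) (Finsupp.mapDomain
          (fun φ : (Orb.free π).quot →[π × π] TwoSided π =>
            φ.comp (Orb.rightTranslation g)) y) =
        Finsupp.mapDomain (g • ·) (Finsupp.equivMapDomain (evalFree π (TwoSided π)) y) := by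
      intro y
      rw [Finsupp.equivMapDomain_eq_mapDomain, Finsupp.equivMapDomain_eq_mapDomain,
        ← Finsupp.mapDomain_comp, ← Finsupp.mapDomain_comp]
      refine congrArg (fun t => Finsupp.mapDomain t y) (funext fun φ => ?_)
      change φ (QuotientGroup.mk (1 * g)) = g • φ (QuotientGroup.mk 1)
      rw [one_mul, ← map_smul]
      exact congrArg φ
        (congrArg (QuotientGroup.mk (s := (⊥ : Subgroup (π × π)))) (mul_one g).symm)
    ext x : 1
    exact Subtype.ext (key x.1))

variable {k π} in
/-- The principal component commutes with tensor products. -/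
def principalTensor (M N : BredonModule k π) :
    (principal k π).obj (M ⊗ N) ≅ (principal k π).obj M ⊗ (principal k π).obj N :=
  Rep.mkIso (.mk (LinearEquiv.refl k _) fun _ => rfl)

/-- The principal component of `Iⁿ` is the `n`-th tensor power of the augmentation ideal. -/
def principalIPow : ∀ n : ℕ, (principal k π).obj (bredonIPow k π n) ≅ augPow k π n
  | 0 => principalUnit
  | 1 => principalI k π
  | n + 2 => principalTensor (bredonI k π) (bredonIPow k π (n + 1)) ≪≫
      (principalI k π ⊗ᵢ principalIPow (n + 1))

section Existence

variable {D : Type u} [Category.{u} D]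

/-- A free module that covers `M`, used to show that every module has a projective resolution. -/
def freeCover (M : D ⥤ ModuleCat.{u} k) : D ⥤ ModuleCat.{u} k where
  obj X := ModuleCat.of k ((Σ Y : D, (Y ⟶ X) × M.obj Y) →₀ k)
  map f := ModuleCat.ofHom (Finsupp.lmapDomain k k fun s => ⟨s.1, s.2.1 ≫ f, s.2.2⟩)
  map_id X := by
    ext : 1
    exact Eq.trans (congrArg (Finsupp.lmapDomain k k) (funext fun s => by simp))
      (Finsupp.lmapDomain_id k k)
  map_comp {X Y Z} f g := by
    ext : 1
    refine Eq.trans ?_ (Finsupp.lmapDomain_comp k k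
      (fun s : (Σ Y : D, (Y ⟶ X) × M.obj Y) => (⟨s.1, s.2.1 ≫ f, s.2.2⟩ :
        Σ Y' : D, (Y' ⟶ Y) × M.obj Y'))
      fun s => (⟨s.1, s.2.1 ≫ g, s.2.2⟩ : Σ Y' : D, (Y' ⟶ Z) × M.obj Y'))
    exact congrArg (Finsupp.lmapDomain k k) (funext fun s => by simp)

variable {k}

/-- The map from the free cover determined by the images of the generators. -/
def freeCoverDesc {M E : D ⥤ ModuleCat.{u} k} (l : ∀ Y, M.obj Y → E.obj Y) :
    freeCover k M ⟶ E where
  app X := ModuleCat.ofHom (Finsupp.linearCombination k fun s => (E.map s.2.1).hom (l s.1 s.2.2))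
  naturality X Y f := by
    ext : 1
    refine Finsupp.lhom_ext fun s r => ?_
    change Finsupp.linearCombination k _ (Finsupp.mapDomain _ (Finsupp.single s r)) =
      (E.map f).hom (Finsupp.linearCombination k _ (Finsupp.single s r))
    rw [Finsupp.mapDomain_single, Finsupp.linearCombination_single,
      Finsupp.linearCombination_single, map_smul, E.map_comp]
    rfl

lemma freeCover_hom_ext {M E : D ⥤ ModuleCat.{u} k} {f g : freeCover k M ⟶ E}
    (h : ∀ Y (m : M.obj Y), (f.app Y).hom (Finsupp.single ⟨Y, 𝟙 Y, m⟩ 1) =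
      (g.app Y).hom (Finsupp.single ⟨Y, 𝟙 Y, m⟩ 1)) : f = g := by
  ext X : 3
  refine Finsupp.lhom_ext' fun s => LinearMap.ext_ring ?_
  obtain ⟨Y, a, m⟩ := s
  have e : (Finsupp.single (⟨Y, a, m⟩ : Σ Y : D, (Y ⟶ X) × M.obj Y) (1 : k)) =
      ((freeCover k M).map a).hom (Finsupp.single ⟨Y, 𝟙 Y, m⟩ 1) := by
    refine Eq.symm ((Finsupp.mapDomain_single).trans ?_)
    simp
  change (f.app X).hom (Finsupp.single _ 1) = (g.app X).hom (Finsupp.single _ 1)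
  rw [e]
  have hf := congrArg (fun t => t.hom (Finsupp.single ⟨Y, 𝟙 Y, m⟩ 1)) (f.naturality a)
  have hg := congrArg (fun t => t.hom (Finsupp.single ⟨Y, 𝟙 Y, m⟩ 1)) (g.naturality a)
  exact hf.trans ((congrArg (E.map a).hom (h Y m)).trans hg.symm)

lemma freeCoverDesc_app {M E : D ⥤ ModuleCat.{u} k} (l : ∀ Y, M.obj Y → E.obj Y) (Y : D)
    (m : M.obj Y) :
    ((freeCoverDesc l).app Y).hom (Finsupp.single ⟨Y, 𝟙 Y, m⟩ 1) = l Y m := by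
  refine (Finsupp.linearCombination_single _ _ _).trans ?_
  simp

lemma app_surjective {E B : D ⥤ ModuleCat.{u} k} (e : E ⟶ B) [Epi e] (Y : D) :
    Function.Surjective (e.app Y).hom :=
  (ModuleCat.epi_iff_surjective _).1 inferInstance

instance (M : D ⥤ ModuleCat.{u} k) : Projective (freeCover k M) where
  factors f e _ := by
    refine ⟨freeCoverDesc fun Y m =>
      (app_surjective e Y ((f.app Y).hom (Finsupp.single ⟨Y, 𝟙 Y, m⟩ 1))).choose, ?_⟩
    refine freeCover_hom_ext fun Y m => ?_
    refine (congrArg (e.app Y).hom (freeCoverDesc_app _ Y m)).trans ?_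
    exact (app_surjective e Y ((f.app Y).hom (Finsupp.single ⟨Y, 𝟙 Y, m⟩ 1))).choose_spec

instance : EnoughProjectives (D ⥤ ModuleCat.{u} k) where
  presentation M := ⟨{
    p := freeCover k M
    f := freeCoverDesc fun _ m => m
    epi := by
      have (Y : D) : Epi ((freeCoverDesc fun _ m => m : freeCover k M ⟶ M).app Y) :=
        (ModuleCat.epi_iff_surjective _).2 fun m => ⟨_, freeCoverDesc_app _ Y m⟩
      exact NatTrans.epi_of_epi_app _ }⟩

end Existence

/-- The constant module has a projective resolution. -/
lemma nonempty_projectiveResolution :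
    Nonempty (ProjectiveResolution (𝟙_ (BredonModule k π))) :=
  (inferInstance : HasProjectiveResolution (𝟙_ (BredonModule k π))).out

section Comparison
variable {k π}

/-- The underlying `k`-module of the principal component of `M` is the value of `M` at `G ⧸ 1`. -/
def principalForget : principal k π ⋙ forget₂ (Rep.{u} k (π × π)) (ModuleCat.{u} k) ≅
    (evaluation _ _).obj (.op (Orb.free π)) :=
  NatIso.ofComponents fun _ => Iso.refl _

instance : Limits.PreservesFiniteLimits (principal k π) := by
  have : Limits.PreservesFiniteLimits
      (principal k π ⋙ forget₂ (Rep.{u} k (π × π)) (ModuleCat.{u} k)) :=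
    Limits.preservesFiniteLimits_of_natIso principalForget.symm
  exact ⟨fun J _ _ =>
    Limits.preservesLimitsOfShape_of_reflects_of_preserves (principal k π)
      (forget₂ (Rep.{u} k (π × π)) (ModuleCat.{u} k))⟩

instance : Limits.PreservesFiniteColimits (principal k π) := by
  have : Limits.PreservesFiniteColimits
      (principal k π ⋙ forget₂ (Rep.{u} k (π × π)) (ModuleCat.{u} k)) :=
    Limits.preservesFiniteColimits_of_natIso principalForget.symm
  exact ⟨fun J _ _ =>
    Limits.preservesColimitsOfShape_of_reflects_of_preserves (principal k π)
      (forget₂ (Rep.{u} k (π × π)) (ModuleCat.{u} k))⟩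

lemma exists_lift {C : Type*} [Category C] [Abelian C] {Y : C} (P : ProjectiveResolution Y)
    (T : ChainComplex C ℕ) (ε : T.X 0 ⟶ Y) (hε : Epi ε) (w : T.d 1 0 ≫ ε = 0)
    (h₀ : (ShortComplex.mk _ _ w).Exact)
    (h : ∀ n, (ShortComplex.mk _ _ (T.d_comp_d (n + 2) (n + 1) n)).Exact) :
    ∃ f : P.complex ⟶ T, f.f 0 ≫ ε = P.π.f 0 := by
  let a : P.complex.X 0 ⟶ Y := P.π.f 0
  let f₀ : P.complex.X 0 ⟶ T.X 0 := Projective.factorThru a ε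
  have hf₀ : f₀ ≫ ε = a := Projective.factorThru_comp _ _
  let f₁ : P.complex.X 1 ⟶ T.X 1 := h₀.liftFromProjective (P.complex.d 1 0 ≫ f₀) (by
    change (P.complex.d 1 0 ≫ f₀) ≫ ε = 0
    rw [Category.assoc, hf₀]
    exact P.complex_d_comp_π_f_zero)
  have hf₁ : f₁ ≫ T.d 1 0 = P.complex.d 1 0 ≫ f₀ := h₀.liftFromProjective_comp _ _
  refine ⟨ChainComplex.mkHom _ _ f₀ f₁ hf₁ fun n ⟨g, g', w⟩ =>
    ⟨(h n).liftFromProjective (P.complex.d (n + 2) (n + 1) ≫ g') ?_,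
      (h n).liftFromProjective_comp _ _⟩, ?_⟩
  · change (P.complex.d (n + 2) (n + 1) ≫ g') ≫ T.d (n + 1) n = 0
    rw [Category.assoc, w, ← Category.assoc, P.complex.d_comp_d, Limits.zero_comp]
  · rw [ChainComplex.mkHom_f_0]
    exact hf₀

/-- The comparison map exists for every projective resolution. -/
lemma nonempty_principalComparison (P : ProjectiveResolution (𝟙_ (BredonModule k π))) :
    Nonempty (PrincipalComparison P) := by
  have : Epi (bredonAug P) := inferInstanceAs (Epi (P.π.f 0))
  have w₀ : P.complex.d 1 0 ≫ bredonAug P = 0 := P.complex_d_comp_π_f_zero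
  have e₀ : (ShortComplex.mk _ _ w₀).Exact := P.exact₀
  have w : (principal k π).map (P.complex.d 1 0) ≫
      (principal k π).map (bredonAug P) ≫ principalUnit.hom = 0 := by
    rw [← Category.assoc, ← Functor.map_comp, w₀, Functor.map_zero, Limits.zero_comp]
  have e : (ShortComplex.mk _ _ w).Exact :=
    ShortComplex.exact_of_iso
      (S₁ := (ShortComplex.mk _ _ w₀).map (principal k π)) (S₂ := ShortComplex.mk _ _ w)
      (ShortComplex.isoMk (Iso.refl _) (Iso.refl _) principalUnit
        ((Category.id_comp _).trans (Category.comp_id _).symm) (Category.id_comp _))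
      (e₀.map (principal k π))
  have hε : Epi ((principal k π).map (bredonAug P) ≫ principalUnit.hom) := by
    have : Epi ((principal k π).map (bredonAug P)) := inferInstance
    exact epi_comp _ _
  obtain ⟨f, hf⟩ := exists_lift (Rep.barResolution k (π × π))
    (((principal k π).mapHomologicalComplex _).obj P.complex)
    ((principal k π).map (bredonAug P) ≫ principalUnit.hom) hε w e
    (fun n => (P.exact_succ n).map (principal k π))
  exact ⟨⟨f.f, fun i => f.comm (i + 1) i, hf⟩⟩

end Comparison

end Orbit

end BredonTC

end

open BredonTC

/-! Every subgroup in the family `D` fixes a point of the $G$-set $\pi$: the diagonal fixes $1$, and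
having a fixed point passes to conjugates and to smaller subgroups. Hence $\mathbb
Z[\pi^H]\to\mathbb Z$ splits for each orbit $G/H$, the splitting survives tensoring with $I^r(G/H)$,
and $(\ast)$ is exact. Maps from a complex of projectives into an exact sequence spliced from short
ones exist, and two of them that agree at the bottom differ by a coboundary at the top
(`exists_spliced_lift`, `exists_spliced_homotopy`). Over the orbit category this shows that
$\mathfrak u^n$ exists and is unique.

For the comparison with $\mathfrak v^n$, the same homotopy lemma is used over $\mathbb Z[G]$, with
the bar resolution as source and the principal component of $(\ast)$ as target; the latter is exact
because `principal` is an exact functor. One chain map is the comparison map followed by the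
principal component of a lift $\underline P_*\to(\ast)$; its top component represents
$\Phi(\mathfrak u^n)$. The other is explicit: the cochains $1\otimes\mathfrak v^i$ with values in
$M\otimes I^i$, and $\mathfrak v^n$ at the top. It is a chain map because $\epsilon(1)=1$ and
because, by the Leibniz rule, $d(1\cup\mathfrak v^i)=d(1)\cup\mathfrak v^i=(i\otimes1)(\mathfrak
v^{i+1})$, where $d(1)$ is the cochain $(x,y)\mapsto xy^{-1}-1$ (`d_basePoint`,
`bredonIPowToC_bredonCocyclePow`). Both lift the identity of $\mathbb Z$, so the top components are
cohomologous. -/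

namespace BredonTC

/-! ### Chain maps into a spliced exact sequence -/

section Spliced

variable {C : Type*} [Category C] [Abelian C] (K : ChainComplex C ℕ) (hK : ∀ i, Projective (K.X i))
  {I T : ℕ → C} {q : ∀ i, T i ⟶ I i} {j : ∀ i, I (i + 1) ⟶ T i} {w : ∀ i, j i ≫ q i = 0}
  (hS : ∀ i, (ShortComplex.mk (j i) (q i) (w i)).ShortExact)

include hK hS in
/-- A cocycle `K 0 → I 0` extends to a chain map into the sequence obtained by splicing the short
exact sequences `0 → I (i + 1) → T i → I i → 0`. -/
theorem exists_spliced_lift (a : K.X 0 ⟶ I 0) (ha : K.d 1 0 ≫ a = 0) :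
    ∃ (φ : ∀ i, K.X i ⟶ T i) (z : ∀ i, K.X i ⟶ I i), z 0 = a ∧ (∀ i, φ i ≫ q i = z i) ∧
      (∀ i, z (i + 1) ≫ j i = K.d (i + 1) i ≫ φ i) ∧ ∀ i, K.d (i + 1) i ≫ z i = 0 := by
  -- Dimension shifting: a cocycle with values in `I i` yields one with values in `I (i + 1)`. The
  -- cocycle condition is part of the data, since it is what makes the next step possible.
  have step : ∀ i (x : {x : K.X i ⟶ I i // K.d (i + 1) i ≫ x = 0}),
      ∃ (φ : K.X i ⟶ T i) (y : {y : K.X (i + 1) ⟶ I (i + 1) // K.d (i + 2) (i + 1) ≫ y = 0}),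
        φ ≫ q i = x.1 ∧ y.1 ≫ j i = K.d (i + 1) i ≫ φ := by
    intro i x
    have : Epi (q i) := (hS i).epi_g
    have : Mono (j i) := (hS i).mono_f
    have := hK i
    have hφ : Projective.factorThru x.1 (q i) ≫ q i = x.1 := Projective.factorThru_comp _ _
    obtain ⟨y, hy⟩ : ∃ y, y ≫ j i = K.d (i + 1) i ≫ Projective.factorThru x.1 (q i) :=
      ⟨_, (hS i).exact.lift_f _ (by
        change (K.d (i + 1) i ≫ Projective.factorThru x.1 (q i)) ≫ q i = 0
        rw [Category.assoc, hφ, x.2])⟩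
    refine ⟨_, ⟨y, ?_⟩, hφ, hy⟩
    rw [← cancel_mono (j i), Category.assoc, hy, ← Category.assoc, K.d_comp_d,
      Limits.zero_comp, Limits.zero_comp]
  choose φ y h₁ h₂ using step
  let z : ∀ i, {x : K.X i ⟶ I i // K.d (i + 1) i ≫ x = 0} := fun i =>
    Nat.rec ⟨a, ha⟩ (fun i x => y i x) i
  exact ⟨fun i => φ i (z i), fun i => (z i).1, rfl, fun i => h₁ i _, fun i => h₂ i _,
    fun i => (z i).2⟩

include hK hS in
/-- Two chain maps into the spliced sequence that agree at `I 0` differ by a coboundary. -/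
theorem exists_spliced_homotopy {n : ℕ} {φ φ' : ∀ i, K.X i ⟶ T i} {z z' : ∀ i, K.X i ⟶ I i}
    (h₀ : z 0 = z' 0) (hq : ∀ i < n, φ i ≫ q i = z i) (hq' : ∀ i < n, φ' i ≫ q i = z' i)
    (hj : ∀ i < n, z (i + 1) ≫ j i = K.d (i + 1) i ≫ φ i)
    (hj' : ∀ i < n, z' (i + 1) ≫ j i = K.d (i + 1) i ≫ φ' i) (i : ℕ) (hi : i < n) :
    ∃ h : K.X i ⟶ I (i + 1), z (i + 1) - z' (i + 1) = K.d (i + 1) i ≫ h := by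
  -- The difference `φ i - φ' i` need not land in `I (i + 1)`. Subtracting a lift `t` of `z i - z'
  -- i` corrects this, and costs nothing after composing with the differential if `t` is a cocycle.
  have main : ∀ i < n, ∀ t : K.X i ⟶ T i, t ≫ q i = z i - z' i → K.d (i + 1) i ≫ t = 0 →
      ∃ h : K.X i ⟶ I (i + 1), z (i + 1) - z' (i + 1) = K.d (i + 1) i ≫ h := by
    intro i hi t ht ht'
    have : Mono (j i) := (hS i).mono_f
    obtain ⟨h, hh⟩ : ∃ h, h ≫ j i = φ i - φ' i - t :=
      ⟨_, (hS i).exact.lift_f _ (by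
        change (φ i - φ' i - t) ≫ q i = 0
        rw [Preadditive.sub_comp, Preadditive.sub_comp, hq i hi, hq' i hi, ht, sub_self])⟩
    refine ⟨h, ?_⟩
    rw [← cancel_mono (j i), Category.assoc, hh, Preadditive.sub_comp, Preadditive.comp_sub,
      Preadditive.comp_sub, ht', hj i hi, hj' i hi, sub_zero]
  induction i with
  | zero => exact main 0 hi 0 (by rw [h₀, sub_self, Limits.zero_comp]) Limits.comp_zero
  | succ i ih =>
    obtain ⟨s, hs⟩ := ih (by omega)
    have : Epi (q (i + 1)) := (hS (i + 1)).epi_g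
    have := hK i
    -- By induction `z (i + 1) - z' (i + 1)` is the coboundary of `s`. The coboundary of a lift of
    -- `s` through `q (i + 1)` lifts this difference and is itself a cocycle.
    refine main (i + 1) hi (K.d (i + 1) i ≫ Projective.factorThru s (q (i + 1))) ?_ ?_
    · rw [Category.assoc, Projective.factorThru_comp, hs]
    · rw [← Category.assoc, K.d_comp_d, Limits.zero_comp]

end Spliced

/-! ### Exactness of the sequence over the orbit category -/

section Exactness

variable {D : Type u} [Category.{u} D] {k : Type u} [CommRing k]

/-- Evaluation functors are exact, so they commute with homology, and a functor is zero when all its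
values are. This reduces exactness of $(\ast)$ to single orbits, where splittings are available. -/
theorem shortExact_of_evaluation {S : ShortComplex (D ⥤ ModuleCat.{u} k)}
    (h : ∀ X, (S.map ((evaluation D (ModuleCat.{u} k)).obj X)).ShortExact) : S.ShortExact where
  exact := by
    rw [ShortComplex.exact_iff_isZero_homology, Functor.isZero_iff]
    exact fun X => ((ShortComplex.exact_iff_isZero_homology _).1 (h X).exact).of_iso
      (S.mapHomologyIso ((evaluation D (ModuleCat.{u} k)).obj X)).symm
  mono_f := by
    have (X : D) : Mono (S.f.app X) := (h X).mono_f
    exact NatTrans.mono_of_mono_app _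
  epi_g := by
    have (X : D) : Epi (S.g.app X) := (h X).epi_g
    exact NatTrans.epi_of_epi_app _

variable {π : Type u} [Group π]

/-- The exactness argument depends on the family `D` through this property alone. A pair $(g,g)$
fixes $1$, conjugation by $g$ moves a fixed point $x$ to $g\cdot x$, and an intersection fixes
whatever one of its members fixes. -/
theorem IsInD.exists_fixed_point {H : Subgroup (π × π)} (h : IsInD π H) :
    ∃ x : TwoSided π, ∀ g ∈ H, g • x = x := by
  induction h with
  | diag =>
    refine ⟨TwoSided.of 1, fun g hg => ?_⟩
    have hg : g.1 = g.2 := hg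
    change g.1 * 1 * g.2⁻¹ = (1 : π)
    rw [hg, mul_one, mul_inv_cancel]
  | bot =>
    refine ⟨TwoSided.of 1, fun g hg => ?_⟩
    rw [Subgroup.mem_bot.1 hg, one_smul]
  | conj g H _ ih =>
    obtain ⟨x, hx⟩ := ih
    refine ⟨g • x, ?_⟩
    rintro _ ⟨a, ha, rfl⟩
    change (g * a * g⁻¹) • g • x = g • x
    rw [smul_smul, inv_mul_cancel_right, mul_smul, hx a ha]
  | inf H K _ _ ih _ =>
    obtain ⟨x, hx⟩ := ih
    exact ⟨x, fun g hg => hx g hg.1⟩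

/-- The orbit map $aH\mapsto a\cdot x$ of an $H$-fixed point $x$ is well defined. It supplies a
basis element of $M_\pi(G/H)$ on which the augmentation is $1$. -/
theorem Orb.nonempty_hom_twoSided (O : Orb π) : Nonempty (O.quot →[π × π] TwoSided π) := by
  obtain ⟨x, hx⟩ := O.mem.exists_fixed_point
  refine ⟨{
    toFun := fun q => Quotient.liftOn' q (· • x) fun a b h => ?_
    map_smul' := fun g q => ?_ }⟩
  · rw [QuotientGroup.leftRel_apply] at h
    have := hx _ h
    rw [mul_smul, inv_smul_eq_iff] at this
    exact this.symm
  · induction q using Quotient.inductionOn' with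
    | h a => exact mul_smul g a x

variable (k π)

theorem augKerι_augmentation (X : Type u) [MulAction (π × π) X] :
    augKerι k π X ≫ augmentation k π X = 0 := by
  ext O : 3
  exact LinearMap.ext fun x => x.2

/-- The sequence `0 → I → M → k → 0`. -/
noncomputable def augSequence : ShortComplex (BredonModule k π) :=
  .mk (augKerι k π (TwoSided π)) (augmentation k π (TwoSided π)) (augKerι_augmentation k π _)

/-- A section sends $1$ to the basis element $\varphi$; the matching retraction is $x\mapsto
x-\epsilon(x)\varphi$. The choice of $\varphi$ is not natural in the orbit, so the splitting is only
asserted objectwise. -/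
theorem nonempty_splitting_augSequence (O : (Orb π)ᵒᵖ) :
    Nonempty (((augSequence k π).map ((evaluation _ (ModuleCat.{u} k)).obj O)).Splitting) := by
  obtain ⟨φ⟩ := O.unop.nonempty_hom_twoSided
  let ε : ((O.unop.quot →[π × π] TwoSided π) →₀ k) →ₗ[k] k :=
    Finsupp.linearCombination k fun _ => (1 : k)
  let s : k →ₗ[k] ((O.unop.quot →[π × π] TwoSided π) →₀ k) := Finsupp.lsingle φ
  have hs : ∀ c, ε (s c) = c := fun c => by simp [ε, s]
  have key : ∀ x, ε x = 0 → x - s (ε x) = x := fun x hx => by rw [hx, map_zero, sub_zero]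
  refine ⟨{
    r := ModuleCat.ofHom (LinearMap.codRestrict (LinearMap.ker ε) (LinearMap.id - s ∘ₗ ε)
      fun x => ?_)
    s := ModuleCat.ofHom s
    f_r := ?_
    s_g := ?_
    id := ?_ }⟩
  · rw [LinearMap.mem_ker]
    change ε (x - s (ε x)) = 0
    rw [map_sub, hs, sub_self]
  · ext x : 2
    apply Subtype.ext
    exact key x.1 x.2
  · ext : 1
    exact LinearMap.ext hs
  · ext : 1
    exact LinearMap.ext fun x => sub_add_cancel x (s (ε x))

theorem bredonIPowToC_comp_bredonCToIPow (n : ℕ) :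
    bredonIPowToC k π n ≫ bredonCToIPow k π n = 0 := by
  cases n with
  | zero => exact augKerι_augmentation k π _
  | succ n =>
    change augKerι k π _ ▷ _ ≫ augmentation k π _ ▷ _ ≫ _ = 0
    rw [← Category.assoc, ← comp_whiskerRight, augKerι_augmentation]
    ext O : 3
    refine TensorProduct.ext' fun x y => ?_
    exact congrArg (λ_ ((bredonIPow k π (n + 1)).obj O)).hom.hom (TensorProduct.zero_tmul _ y) |>.trans (map_zero _)

/-- An additive functor preserves split sequences, so tensoring with $I^{n+1}(G/H)$ needs no
flatness. The left unitor accounts for $k\otimes I^{n+1}=I^{n+1}$ at the right end. -/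
theorem bredon_shortExact (n : ℕ) : (ShortComplex.mk (bredonIPowToC k π n) (bredonCToIPow k π n)
    (bredonIPowToC_comp_bredonCToIPow k π n)).ShortExact := by
  cases n with
  | zero =>
    exact shortExact_of_evaluation fun O => (nonempty_splitting_augSequence k π O).some.shortExact
  | succ n =>
    refine shortExact_of_evaluation fun O => ?_
    refine ShortComplex.shortExact_of_iso (S₁ := ((augSequence k π).map
      ((evaluation _ (ModuleCat.{u} k)).obj O)).map
        (tensorRight ((bredonIPow k π (n + 1)).obj O)))
      (ShortComplex.isoMk (Iso.refl _) (Iso.refl _)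
      (λ_ ((bredonIPow k π (n + 1)).obj O)) ?_ ?_)
      ((nonempty_splitting_augSequence k π O).some.map
        (tensorRight ((bredonIPow k π (n + 1)).obj O))).shortExact
    · exact (Category.id_comp _).trans (Category.comp_id _).symm
    · exact Category.id_comp _

end Exactness

/-! ### Homology classes through representing cochains -/

section Homology

variable {k : Type u} [CommRing k]

theorem homologyMap_homologyπ {K L : CochainComplex (ModuleCat.{u} k) ℕ} (f : K ⟶ L) {n : ℕ}
    {a : K.cycles n} {b : L.cycles n} (h : L.iCycles n b = f.f n (K.iCycles n a)) :
    HomologicalComplex.homologyMap f n (K.homologyπ n a) = L.homologyπ n b := by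
  have e : HomologicalComplex.cyclesMap f n a = b := by
    apply (ModuleCat.mono_iff_injective (L.iCycles n)).1 inferInstance
    rw [h]
    exact congrArg (fun t => t.hom a) (HomologicalComplex.cyclesMap_i f n)
  rw [← e]
  exact congrArg (fun t => t.hom a) (HomologicalComplex.homologyπ_naturality f n)

theorem homologyπ_eq_of_sub_eq_d {K : CochainComplex (ModuleCat.{u} k) ℕ} {n : ℕ}
    {a b : K.cycles (n + 1)} (c : K.X n)
    (h : K.iCycles (n + 1) a - K.iCycles (n + 1) b = K.d n (n + 1) c) :
    K.homologyπ (n + 1) a = K.homologyπ (n + 1) b := by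
  have e : a - b = K.toCycles n (n + 1) c := by
    apply (ModuleCat.mono_iff_injective (K.iCycles (n + 1))).1 inferInstance
    rw [map_sub, h]
    exact congrArg (fun t => t.hom c) (HomologicalComplex.toCycles_i K n (n + 1)).symm
  rw [← sub_eq_zero, ← map_sub, e]
  exact congrArg (fun t => t.hom c) (HomologicalComplex.toCycles_comp_homologyπ K n (n + 1))

end Homology

/-! ### Inhomogeneous cochains as maps out of the bar complex -/

section Cochains

variable {k G : Type u} [CommRing k] [Group G]

/-- The inhomogeneous cochain of a homomorphism defined on the bar complex. -/
noncomputable def barCochain {A : Rep.{u} k G} {n : ℕ} (f : (Rep.barComplex k G).X n ⟶ A) :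
    (Fin n → G) → A :=
  Rep.freeLiftLEquiv k G (Fin n → G) A f

theorem barCochain_injective (A : Rep.{u} k G) (n : ℕ) :
    Function.Injective (barCochain : ((Rep.barComplex k G).X n ⟶ A) → _) :=
  (Rep.freeLiftLEquiv k G (Fin n → G) A).injective

theorem barCochain_surjective (A : Rep.{u} k G) (n : ℕ) :
    Function.Surjective (barCochain : ((Rep.barComplex k G).X n ⟶ A) → _) :=
  (Rep.freeLiftLEquiv k G (Fin n → G) A).surjective

theorem barCochain_comp {A B : Rep.{u} k G} {n : ℕ} (f : (Rep.barComplex k G).X n ⟶ A)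
    (u : A ⟶ B) (g : Fin n → G) : barCochain (f ≫ u) g = u.hom (barCochain f g) := rfl

theorem barCochain_sub {A : Rep.{u} k G} {n : ℕ} (f g : (Rep.barComplex k G).X n ⟶ A) :
    barCochain (f - g) = barCochain f - barCochain g :=
  map_sub (Rep.freeLiftLEquiv k G (Fin n → G) A) f g

theorem d_barCochain {A : Rep.{u} k G} {n : ℕ} (f : (Rep.barComplex k G).X n ⟶ A) :
    inhomogeneousCochains.d A n (barCochain f) =
      barCochain ((Rep.barComplex k G).d (n + 1) n ≫ f) := by
  rw [inhomogeneousCochains.d_eq]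
  exact congrArg (fun x => barCochain ((Rep.barComplex k G).d (n + 1) n ≫ x))
    ((Rep.freeLiftLEquiv k G (Fin n → G) A).symm_apply_apply f)

/-- Every cochain comes from a map on the bar complex; the differential is precomposition and a
change of coefficients is postcomposition, so the two commute. -/
theorem d_hom_comp {A B : Rep.{u} k G} {n : ℕ} (u : A ⟶ B) (a : (Fin n → G) → A) :
    inhomogeneousCochains.d B n (fun g => u.hom (a g)) =
      fun g => u.hom (inhomogeneousCochains.d A n a g) := by
  obtain ⟨f, rfl⟩ := barCochain_surjective A n a
  rw [d_barCochain]
  exact d_barCochain (f ≫ u)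

/-- This is the passage from bar notation to homogeneous tuples, $g[f_1|\dots|f_m]\mapsto
g\,(1,f_1,f_1f_2,\dots)$. It serves to compute the bar augmentation on the degree $0$ generator. -/
theorem diagonalSuccIsoFree_inv_single (m : ℕ) (f : Fin m → G) (g : G) (r : k) :
    (Rep.diagonalSuccIsoFree k G m).inv.hom (Finsupp.single f (MonoidAlgebra.single g r)) =
      MonoidAlgebra.single (g • Fin.partialProd f) r := by
  simp only [Rep.diagonalSuccIsoFree, Rep.diagonalSuccIsoTensorTrivial, Iso.trans_inv,
    Rep.hom_comp, Representation.IntertwiningMap.comp_apply]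
  have step1 : (Rep.Hom.hom (Rep.leftRegularTensorTrivialIsoFree k G (Fin m → G)).inv)
      (Finsupp.single f (.single g r)) = .single g 1 ⊗ₜ[k] .single f r :=
    Representation.leftRegularTensorTrivialIsoFree_symm_apply_single_single f g r
  rw [step1]
  have key₁ := Representation.linearizeMap_single (k := k)
    (Action.diagonalSuccIsoTensorTrivial G m).inv (g, f) ((1 : k) * r)
  have key₂ := Representation.LinearizeMonoidal.μ_apply_single_single (k := k)
    (X := Action.leftRegular G) (Y := Action.trivial G (Fin m → G)) g f 1 r
  exact ((congrArg (fun z => (Representation.linearizeMap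
    (Action.diagonalSuccIsoTensorTrivial G m).inv) z) key₂).trans key₁).trans (by
    rw [one_mul, Action.diagonalSuccIsoTensorTrivial_inv_hom_apply])

/-- The augmentation of the bar resolution is that of the standard complex, transported along the
degree $0$ isomorphism; the latter sends every one-element tuple to $1$. -/
theorem barCochain_ε :
    barCochain ((Rep.barResolution k G).π.f 0 : (Rep.barComplex k G).X 0 ⟶ Rep.trivial k G k) =
      fun _ => (1 : k) := by
  funext g
  have e : ((Rep.barResolution k G).π.f 0 : (Rep.barComplex k G).X 0 ⟶ Rep.trivial k G k) =
      (Rep.diagonalSuccIsoFree k G 0).inv ≫ Rep.standardComplex.ε k G := by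
    refine (HomologicalComplex.comp_f _ _ 0).trans ?_
    exact congrArg ((Rep.diagonalSuccIsoFree k G 0).inv ≫ ·)
      (ChainComplex.toSingle₀Equiv_symm_apply_f_zero _ _)
  rw [e]
  change (Rep.standardComplex.ε k G).hom ((Rep.diagonalSuccIsoFree k G 0).inv.hom
    (Finsupp.single g (MonoidAlgebra.single 1 1))) = 1
  rw [diagonalSuccIsoFree_inv_single]
  exact (Finsupp.linearCombination_single _ _ _).trans (one_smul _ _)

end Cochains

/-! ### The explicit chain map given by cup powers of the crossed homomorphism -/

section Canonical

variable (k : Type u) [CommRing k] (π : Type u) [Group π]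

/-- The base point of `M (G ⧸ 1) = k[π]`. -/
noncomputable def basePoint : (principal k π).obj (freeMod k π (TwoSided π)) :=
  (Finsupp.single ((evalFree π (TwoSided π)).symm (TwoSided.of 1)) (1 : k) :
    ((Orb.free π).quot →[π × π] TwoSided π) →₀ k)

/-- The crossed homomorphism `(x, y) ↦ x y⁻¹ - 1` with values in `I (G ⧸ 1)`. -/
noncomputable def bredonCocycle (g : π × π) : (principal k π).obj (bredonI k π) :=
  (principalI k π).inv.hom (canonicalCocycle k π g)

/-- The cup powers of the crossed homomorphism, with values in `Iⁿ (G ⧸ 1)`. -/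
noncomputable def bredonCocyclePow :
    ∀ n, (Fin n → π × π) → (principal k π).obj (bredonIPow k π n)
  | 0 => fun _ => (1 : k)
  | 1 => fun g => bredonCocycle k π (g 0)
  | n + 2 => cupCochain (A := (principal k π).obj (bredonI k π))
      (B := (principal k π).obj (bredonIPow k π (n + 1))) (show 1 + (n + 1) = n + 2 by omega)
      (fun g => bredonCocycle k π (g 0)) (bredonCocyclePow (n + 1))

/-- The cochain `1 ⊗ vⁿ` with values in `(M ⊗ Iⁿ) (G ⧸ 1)`, where `vⁿ` is the cup power of the crossed
homomorphism. -/
noncomputable def bredonCochainC :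
    ∀ n, (Fin n → π × π) → (principal k π).obj (bredonC k π n)
  | 0 => fun _ => basePoint k π
  | n + 1 => cupCochain (A := (principal k π).obj (freeMod k π (TwoSided π)))
      (B := (principal k π).obj (bredonIPow k π (n + 1))) (show 0 + (n + 1) = n + 1 by omega)
      (fun _ => basePoint k π) (bredonCocyclePow k π (n + 1))

theorem bredonCToIPow_bredonCochainC (n : ℕ) (g : Fin n → π × π) :
    ((principal k π).map (bredonCToIPow k π n)).hom (bredonCochainC k π n g) =
      bredonCocyclePow k π n g := by
  have h₀ : ((principal k π).map (augmentation k π (TwoSided π))).hom (basePoint k π) = (1 : k) :=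
    (Finsupp.linearCombination_single _ _ _).trans (one_smul _ _)
  cases n with
  | zero => exact h₀
  | succ n =>
    -- A left factor of degree $0$ introduces no twist: the partial product at index $0$ is $1$.
    -- Only the shift `0 + j` in the arguments has to be removed.
    have e : bredonCochainC k π (n + 1) g = basePoint k π ⊗ₜ[k] bredonCocyclePow k π (n + 1) g := by
      have h₁ : (fun j : Fin (n + 1) => g ⟨0 + j, by omega⟩) = g :=
        funext fun j => congrArg g (Fin.ext (Nat.zero_add _))
      change basePoint k π ⊗ₜ[k] ((principal k π).obj (bredonIPow k π (n + 1))).ρ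
        (Fin.partialProd g 0) (bredonCocyclePow k π (n + 1) fun j => g ⟨0 + j, by omega⟩) = _
      rw [h₁, Fin.partialProd_zero, map_one]
      rfl
    rw [e]
    exact (congrArg (fun c : k => c • bredonCocyclePow k π (n + 1) g) h₀).trans (one_smul _ _)

/-- Since $(x,y)\cdot1=xy^{-1}$, the crossed homomorphism becomes principal once its values are
taken in $M=\mathbb Z[\pi]$. The identity is checked after identifying $M(G/1)$ with $k[\pi]$ by
evaluation at the base coset. -/
theorem augKerι_bredonCocycle (g : π × π) :
    ((principal k π).map (augKerι k π (TwoSided π))).hom (bredonCocycle k π g) =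
      ((principal k π).obj (freeMod k π (TwoSided π))).ρ g (basePoint k π) - basePoint k π := by
  let L := Finsupp.domLCongr (R := k) (M := k) (evalFree π (TwoSided π))
  have h : (principalI k π).hom.hom (bredonCocycle k π g) = canonicalCocycle k π g :=
    congrArg (fun t => t.hom (canonicalCocycle k π g)) (principalI k π).inv_hom_id
  have hb : L (basePoint k π) = Finsupp.single (TwoSided.of 1) 1 :=
    (Finsupp.domLCongr_single _ _ _).trans
      (congrArg (Finsupp.single · 1) (Equiv.apply_symm_apply _ _))
  have hg : L (((principal k π).obj (freeMod k π (TwoSided π))).ρ g (basePoint k π)) =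
      Finsupp.single (TwoSided.of (g.1 * g.2⁻¹)) 1 := by
    refine (congrArg L (Finsupp.mapDomain_single)).trans
      ((Finsupp.domLCongr_single _ _ _).trans (congrArg (Finsupp.single · 1) ?_))
    change (1 * g).1 * 1 * (1 * g).2⁻¹ = g.1 * g.2⁻¹
    rw [one_mul, mul_one]
  apply L.injective
  refine (congrArg Subtype.val h).trans ?_
  refine Eq.symm ((map_sub L _ _).trans ?_)
  rw [hb, hg]
  rfl

/-- In other words, $\mathfrak v$ is the image of $1$ under the connecting map of $0\to I\to M\to
k\to0$. This is the lowest square of the explicit chain map. -/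
theorem d_basePoint :
    inhomogeneousCochains.d ((principal k π).obj (freeMod k π (TwoSided π))) 0
      (fun _ => basePoint k π) = fun g => ((principal k π).map (augKerι k π (TwoSided π))).hom
        (bredonCocycle k π (g 0)) := by
  funext g
  rw [augKerι_bredonCocycle, inhomogeneousCochains.d_hom_apply]
  simp [sub_eq_add_neg]

/-- The product `cup` is defined through chosen representatives, so the cocycle underlying
`canonicalClassPow` is not explicit. By `cup_π_π` any representatives may be used, and the recursion
exhibits the expected cup power. -/
theorem exists_cocycle_canonicalClassPow : ∀ n : ℕ,
    ∃ a : groupCohomology.cocycles (augPow k π n) n,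
      groupCohomology.π _ n a = canonicalClassPow k π n ∧
      groupCohomology.iCocycles _ n a =
        fun g => (principalIPow k π n).hom.hom (bredonCocyclePow k π n g)
  | 0 => ⟨_, rfl, groupCohomology.iCocycles_mk _ _⟩
  | 1 => by
    refine ⟨(groupCohomology.isoCocycles₁ (augIdeal k π)).inv (canonicalCocycle k π), rfl, ?_⟩
    refine (groupCohomology.isoCocycles₁_inv_comp_iCocycles_apply _ _).trans (funext fun g => ?_)
    exact (congrArg (fun t => t.hom (canonicalCocycle k π (g 0)))
      (principalI k π).inv_hom_id).symm
  | n + 2 => by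
    obtain ⟨a, ha, ha'⟩ := exists_cocycle_canonicalClassPow 1
    obtain ⟨b, hb, hb'⟩ := exists_cocycle_canonicalClassPow (n + 1)
    refine ⟨cupCocycle (show 1 + (n + 1) = n + 2 by omega) a b, ?_, ?_⟩
    · refine (cup_π_π _ a b).symm.trans ?_
      rw [hb]
      exact congrArg (fun x => cup (show 1 + (n + 1) = n + 2 by omega) x
        (canonicalClassPow k π (n + 1))) ha
    · refine (iCocycles_cupCocycle _ a b).trans (funext fun g => ?_)
      refine (congrArg₂ (fun x y => cupCochain (A := augIdeal k π) (B := augPow k π (n + 1))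
        (show 1 + (n + 1) = n + 2 by omega) x y g) ha' hb').trans ?_
      -- The second cup factor is twisted by the group, so equivariance of `principalIPow` is needed
      -- to carry the identification past the action.
      have h := Rep.hom_comm_apply (principalIPow k π (n + 1)).hom
        (Fin.partialProd g ⟨1, by omega⟩)
        (bredonCocyclePow k π (n + 1) fun j => g ⟨1 + j, by omega⟩)
      exact congrArg (fun t => (principalI k π).hom.hom (bredonCocycle k π (g 0)) ⊗ₜ[k] t) h.symm

/-- The isomorphism `principalIPow` turns this cochain into the cocycle found above, and
coboundaries commute with changes of coefficients. -/
theorem d_bredonCocyclePow (n : ℕ) :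
    inhomogeneousCochains.d _ n (bredonCocyclePow k π n) = 0 := by
  obtain ⟨a, -, ha⟩ := exists_cocycle_canonicalClassPow k π n
  have h := d_iCocycles a
  rw [ha, d_hom_comp] at h
  funext g
  have hg := congrArg (principalIPow k π n).inv.hom (congrFun h g)
  refine Eq.trans ?_ (hg.trans (map_zero _))
  exact (congrArg (fun t => t.hom (inhomogeneousCochains.d _ n (bredonCocyclePow k π n) g))
    (principalIPow k π n).hom_inv_id).symm

/-- This is the Leibniz rule for $1\cup\mathfrak v^n$. The term with $d\mathfrak v^n$ vanishes,
taking the sign with it, and $d(1)\cup\mathfrak v^n$ is $(i\otimes1)(\mathfrak v^{n+1})$ because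
powers are built by adding factors on the left. -/
theorem bredonIPowToC_bredonCocyclePow (n : ℕ) :
    (fun g => ((principal k π).map (bredonIPowToC k π n)).hom (bredonCocyclePow k π (n + 1) g)) =
      inhomogeneousCochains.d _ n (bredonCochainC k π n) := by
  cases n with
  | zero => exact (d_basePoint k π).symm
  | succ n =>
    have h := d_cupCochain (A := (principal k π).obj (freeMod k π (TwoSided π)))
      (B := (principal k π).obj (bredonIPow k π (n + 1))) (show 0 + (n + 1) = n + 1 by omega)
      (fun _ => basePoint k π) (bredonCocyclePow k π (n + 1))
    rw [d_basePoint, d_bredonCocyclePow, cupCochain_zero_right, smul_zero, add_zero] at h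
    exact h.symm

end Canonical

/-! ### Uniqueness of the canonical power and its image under the comparison -/

section Main

variable {k : Type u} [CommRing k] {π : Type u} [Group π]
  {P : ProjectiveResolution (𝟙_ (BredonModule k π))}

theorem iCycles_cyclesMk_linearYonedaObj {M : BredonModule k π} {n : ℕ} (f : P.complex.X n ⟶ M)
    (hf : P.complex.d (n + 1) n ≫ f = 0) :
    (P.complex.linearYonedaObj k M).iCycles n
      ((P.complex.linearYonedaObj k M).cyclesMk f (n + 1) (by simp) hf) = f :=
  (P.complex.linearYonedaObj k M).i_cyclesMk f (n + 1) (by simp) hf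

theorem exists_canonicalPowerDiagram (n : ℕ) : Nonempty (CanonicalPowerDiagram P n) := by
  obtain ⟨φ, z, h₀, h₁, h₂, h₃⟩ := exists_spliced_lift P.complex P.projective
    (bredon_shortExact k π) (bredonAug P) P.complex_d_comp_π_f_zero
  exact ⟨⟨φ, z, h₀, fun i _ => h₁ i, fun i _ => h₂ i, h₃ n⟩⟩

theorem bredonClass_eq_bredonClass {n : ℕ} (hn : 1 ≤ n) (D D' : CanonicalPowerDiagram P n) :
    bredonClass P _ n (D.z n) D.cocycle = bredonClass P _ n (D'.z n) D'.cocycle := by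
  obtain ⟨m, rfl⟩ : ∃ m, n = m + 1 := ⟨n - 1, by omega⟩
  obtain ⟨h, hh⟩ := exists_spliced_homotopy P.complex P.projective (bredon_shortExact k π)
    (D.z_zero.trans D'.z_zero.symm) D.φ_comp D'.φ_comp D.z_comp D'.z_comp m (by omega)
  refine homologyπ_eq_of_sub_eq_d h ?_
  rw [iCycles_cyclesMk_linearYonedaObj, iCycles_cyclesMk_linearYonedaObj]
  exact hh

theorem map_Phi_bredonClass {n : ℕ} (hn : 1 ≤ n) (θ : PrincipalComparison P)
    (D : CanonicalPowerDiagram P n) :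
    groupCohomology.map (MonoidHom.id (π × π)) (principalIPow k π n).hom n
        (Phi (bredonIPow k π n) n θ (bredonClass P _ n (D.z n) D.cocycle)) =
      canonicalClassPow k π n := by
  obtain ⟨a, ha, ha'⟩ := exists_cocycle_canonicalClassPow k π n
  obtain ⟨m, rfl⟩ : ∃ m, n = m + 1 := ⟨n - 1, by omega⟩
  -- `Z` and `T` are the explicit lift in the form of maps on the bar complex: `Z i` corresponds to
  -- $\mathfrak v^i$ and `T i` to $1\otimes\mathfrak v^i$.
  choose Z hZ using fun i => barCochain_surjective _ _ (bredonCocyclePow k π i)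
  choose T hT using fun i => barCochain_surjective _ _ (bredonCochainC k π i)
  -- The target is the principal component of the spliced sequence, still exact since `principal`
  -- is. The five conditions say that the two families agree in degree $0$ and that both are chain
  -- maps.
  obtain ⟨h, hh⟩ := exists_spliced_homotopy (Rep.barComplex k (π × π))
    (Rep.barResolution k (π × π)).projective
    (fun i => (bredon_shortExact k π i).map_of_exact (principal k π)) (n := m + 1)
    (φ := fun i => θ.f i ≫ (principal k π).map (D.φ i))
    (z := fun i => θ.f i ≫ (principal k π).map (D.z i)) (φ' := T) (z' := Z)
    (by
      -- In degree $0$ both maps are the augmentation of the bar resolution, whose cochain is the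
      -- constant $1$.
      refine (cancel_mono (principalUnit (k := k) (π := π)).hom).1 ?_
      rw [D.z_zero]
      refine ((Category.assoc _ _ _).trans θ.comm_augmentation).trans ?_
      apply barCochain_injective
      refine barCochain_ε.trans (funext fun g => ?_)
      exact (congrFun (hZ 0) g).symm)
    (fun i hi => by
      dsimp only
      rw [Category.assoc, ← D.φ_comp i hi, Functor.map_comp])
    (fun i _ => by
      apply barCochain_injective
      funext g
      rw [barCochain_comp, hT, hZ]
      exact bredonCToIPow_bredonCochainC k π i g)
    (fun i hi => by
      dsimp only
      rw [Category.assoc, ← Functor.map_comp, D.z_comp i hi, Functor.map_comp, ← Category.assoc,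
        θ.comm, Category.assoc])
    (fun i _ => by
      apply barCochain_injective
      rw [← d_barCochain, hT, ← bredonIPowToC_bredonCocyclePow, ← hZ]
      rfl)
    m (by omega)
  -- The coefficient map `u` is left free because the cocycle occurs twice: with values in
  -- $I^{m+1}(G/1)$ and, after `principalIPow`, in the tensor power of the augmentation ideal.
  have hd : ∀ {A : Rep.{u} k (π × π)} (u : (principal k π).obj (bredonIPow k π (m + 1)) ⟶ A),
      inhomogeneousCochains.d A (m + 1)
        (barCochain ((θ.f (m + 1) ≫ (principal k π).map (D.z (m + 1))) ≫ u)) = 0 := fun u => by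
    rw [d_barCochain, Category.assoc, ← Category.assoc, ← θ.comm, Category.assoc,
      ← Category.assoc ((principal k π).map _), ← Functor.map_comp, D.cocycle, Functor.map_zero,
      Limits.zero_comp, Limits.comp_zero]
    exact map_zero (Rep.freeLiftLEquiv k _ _ _)
  have e₁ : Phi (bredonIPow k π (m + 1)) (m + 1) θ (bredonClass P _ (m + 1) (D.z (m + 1)) D.cocycle) =
      groupCohomology.π _ (m + 1) (groupCohomology.cocyclesMk _ (hd (𝟙 _))) := by
    refine homologyMap_homologyπ _ ?_
    rw [iCycles_cyclesMk_linearYonedaObj]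
    refine (groupCohomology.iCocycles_mk _ (hd (𝟙 _))).trans ?_
    rw [Category.comp_id]
    rfl
  have e₂ : groupCohomology.map (MonoidHom.id (π × π)) (principalIPow k π (m + 1)).hom (m + 1)
      (groupCohomology.π _ (m + 1) (groupCohomology.cocyclesMk _ (hd (𝟙 _)))) =
      groupCohomology.π _ (m + 1)
        (groupCohomology.cocyclesMk _ (hd (principalIPow k π (m + 1)).hom)) := by
    refine homologyMap_homologyπ _ ?_
    refine (groupCohomology.iCocycles_mk _ (hd (principalIPow k π (m + 1)).hom)).trans ?_
    refine Eq.trans ?_ (congrArg _ (groupCohomology.iCocycles_mk _ (hd (𝟙 _))).symm)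
    rw [Category.comp_id]
    rfl
  rw [e₁, e₂, ← ha]
  -- The bounding cochain is the homotopy `h`, carried to the tensor power of the augmentation
  -- ideal.
  refine homologyπ_eq_of_sub_eq_d (barCochain (h ≫ (principalIPow k π (m + 1)).hom)) ?_
  refine (congrArg₂ (· - ·) (groupCohomology.iCocycles_mk _ (hd _)) ha').trans ?_
  rw [groupCohomology.inhomogeneousCochains.d_def, d_barCochain, ← Category.assoc]
  have hh' : (θ.f (m + 1) ≫ (principal k π).map (D.z (m + 1))) - Z (m + 1) =
    (Rep.barComplex k (π × π)).d (m + 1) m ≫ h := hh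
  have hW : (fun g => (principalIPow k π (m + 1)).hom.hom (bredonCocyclePow k π (m + 1) g)) =
      barCochain (Z (m + 1) ≫ (principalIPow k π (m + 1)).hom) := by
    rw [← hZ]
    rfl
  rw [hW, ← hh', Preadditive.sub_comp, barCochain_sub]

end Main
end BredonTC

/-- `ULift ℤ` is $\mathbb Z$ placed in the universe of `π`. The equivalence with `c = u` holds two
claims: taking `c = u` gives a chain map, and the forward direction gives independence of its
choice. Mapping along `principalIPow` is the identification of $\underline I^n(G/1)$ with $I^n$. -/
theorem mainTheorem7 {π : Type u} [Group π] (n : ℕ) (hn : 1 ≤ n)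
    (P : ProjectiveResolution (𝟙_ (BredonModule (ULift.{u} ℤ) π))) (θ : PrincipalComparison P) :
    ∃ u : bredonCohomology P (bredonIPow (ULift.{u} ℤ) π n) n,
      (∀ c : bredonCohomology P (bredonIPow (ULift.{u} ℤ) π n) n,
        IsCanonicalPower P n c ↔ c = u) ∧
      groupCohomology.map (MonoidHom.id (π × π)) (principalIPow (ULift.{u} ℤ) π n).hom n
          (Phi (bredonIPow (ULift.{u} ℤ) π n) n θ u) =
        canonicalClassPow (ULift.{u} ℤ) π n := by
  obtain ⟨D⟩ := exists_canonicalPowerDiagram (P := P) n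
  refine ⟨_, fun c => ⟨?_, fun h => ⟨D, h⟩⟩, map_Phi_bredonClass hn θ D⟩
  rintro ⟨D', rfl⟩
  exact bredonClass_eq_bredonClass hn D' D
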